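/- **Theorem 2 (Chance Constraint Satisfaction).** Consider the system $x(k+1)=Ax(k)+Bu(k)+w(k)$ in $\mathbb R^n$ with inputs in $\mathbb R^m$ and a given initial state $x(0)$, where the noise $w(k)$ is independent and identically distributed with a law $\mathcal Q_w$ that has zero mean and finite, positive definite variance and is central convex unimodal, i.e. lies in the weakly closed convex hull of all uniform distributions on symmetric compact convex bodies in $\mathbb R^n$. Let $\mathcal X\subseteq\mathbb R^n$ and $\mathcal U\subseteq\mathbb R^m$ be convex sets with the origin in their interior and let $\bar p_x,\bar p_u\in[0,1)$ be the target probability levels. Let $Q,R$ be positive definite weights, let $P$ be a stabilizing positive semidefinite solution of the discrete algebraic Riccati equation $P=A^TPA+A^TPBK+Q$ with $K=-(R+B^TPB)^{-1}B^TPA$, so that $A_K=A+BK$ has all its eigenvalues strictly inside the unit circle, and put $S=R+B^TPB$ and $\|y\|_S^2=y^TSy$. *Reachable sets.* For a positive semidefinite matrix $E$ let $\mathcal E(E)=\{y : (l^Ty)^2\le l^TEl\ \ \forall l\}$, which is $\{y: y^TE^{-1}y\le1\}$ if $E$ is positive definite. Let $\Sigma_\infty$ solve $A_K\Sigma_\infty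 A_K^T-\Sigma_\infty+\mathrm{var}(\mathcal Q_w)=0$. For $p\in[0,1)$ let $\tilde p=\frac{n}{1-p}$ or, if $\mathcal Q_w$ is Gaussian, alternatively let $\tilde p=\chi_n^2(p)$ be the $p$-quantile of the chi-squared distribution with $n$ degrees of freedom (the same choice for all $p$). Put $\mathcal R_x(p)=\mathcal E(\tilde p\,\Sigma_\infty)$ and $\mathcal R_u(p)=\mathcal E(\tilde p\,K\Sigma_\infty K^T)$. Write $S_1\ominus S_2=\{a : a+b\in S_1\ \forall b\in S_2\}$, and for $\alpha,\beta\in[0,1]$ let $\mathcal Z_\alpha=\mathcal X\ominus(1-\alpha)\mathcal R_x(\bar p_x)$ and $\mathcal V_\beta=\mathcal U\ominus(1-\beta)\mathcal R_u(\bar p_u)$ be the tightened constraint sets. Let $N\ge1$ and let $\mathcal Z_F$ be a terminal set with $A_K\mathcal Z_F\subseteq\mathcal Z_F\subseteq\mathcal Z_0$ and $K\mathcal Z_F\subseteq\mathcal V_0$. *Safety step.* Let $(\bar v,\alpha^*,\beta^*)$ minimize $\sum_{i=0}^{N-1}(\alpha(i)+\beta(i))$ subject to $z(0)=x(0)$,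 $z(i+1)=Az(i)+Bv(i)$, $z(i)\in\mathcal Z_{\alpha(i)}$, $v(i)\in\mathcal V_{\beta(i)}$, $\alpha(i),\beta(i)\in[0,1]$ for $0\le i<N$, and $z(N)\in\mathcal Z_F$. Extend $\alpha^*,\beta^*$ by $0$ to all times. The relaxed level $p_x(k)$ is the level of the reachable set $(1-\alpha^*(k))\mathcal R_x(\bar p_x)$, that is, the largest $p\in[0,\bar p_x]$ with $\mathcal R_x(p)=(1-\alpha^*(k))\mathcal R_x(\bar p_x)$, and $p_x(k)=0$ if there is no such $p$; $p_u(k)$ is defined in the same way from $\beta^*(k)$, $\mathcal R_u$ and $\bar p_u$. *Performance step and control law.* At each time $k\ge0$, with $z_1(-1)=x(0)$, consider the problem of minimizing $\sum_{i=0}^{N-1}\|v_i(k)-Kz_i(k)\|_S^2+l(\xi(k))$, where $l$ is a given penalty function, over $v_0(k),\dots,v_{N-1}(k)$ and $\xi(k)\in\{0,1\}$, subject to $z_0(k)=(1-\xi(k))x(k)+\xi(k)z_1(k-1)$, $z_{i+1}(k)=Az_i(k)+Bv_i(k)$, $z_i(k)\in\mathcal Z_{\alpha^*(k+i)}$, $v_i(k)\in\mathcal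 V_{\beta^*(k+i)}$ for $0\le i<N$, and $z_N(k)\in\mathcal Z_F$. Let the controller be a measurable rule that, as a function of $k$, $x(k)$ and $z_1(k-1)$, returns an optimal solution of this problem whenever the problem is feasible, and let the input $u(k)=v_0(k)+K\,(x(k)-z_0(k))$ be applied. Then, for every $k\ge0$, the closed loop satisfies $$\mathbb P\big(x(k)\in\mathcal X\mid x(0)\big)\ge p_x(k),\qquad \mathbb P\big(u(k)\in\mathcal U\mid x(0)\big)\ge p_u(k).$$ -/

import Mathlib

open MeasureTheory ProbabilityTheory Set
open scoped NNReal Pointwise Matrix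

/-- The Pontryagin (Minkowski) set difference `S ⊖ T`. -/
def pontryaginDiff {d : ℕ} (S T : Set (Fin d → ℝ)) : Set (Fin d → ℝ) :=
  {a | ∀ b ∈ T, a + b ∈ S}

/-- The (possibly degenerate) ellipsoid centred at the origin with positive semidefinite shape
matrix `E`, written through its support function `l ↦ √(lᵀ E l)`. For positive definite `E` it is
`{x | xᵀ E⁻¹ x ≤ 1}`, see `ellipsoid_eq_of_posDef`. -/
def ellipsoid {d : ℕ} (E : Matrix (Fin d) (Fin d) ℝ) : Set (Fin d → ℝ) :=
  {x | ∀ l : Fin d → ℝ, (l ⬝ᵥ x) ^ 2 ≤ l ⬝ᵥ (E *ᵥ l)}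

theorem ellipsoid_eq_of_posDef {d : ℕ} {E : Matrix (Fin d) (Fin d) ℝ} (hE : E.PosDef) :
    ellipsoid E = {x | x ⬝ᵥ (E⁻¹ *ᵥ x) ≤ 1} := by
  have hu : IsUnit E.det := hE.det_pos.ne'.isUnit
  have hsymm : ∀ a b : Fin d → ℝ, a ⬝ᵥ (E *ᵥ b) = b ⬝ᵥ (E *ᵥ a) := by
    intro a b
    have ht : Eᵀ = E := by simpa [Matrix.IsHermitian] using hE.isHermitian
    rw [Matrix.dotProduct_mulVec, ← Matrix.mulVec_transpose, ht, dotProduct_comm]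
  ext x
  have hx : E *ᵥ (E⁻¹ *ᵥ x) = x := by
    rw [Matrix.mulVec_mulVec, Matrix.mul_nonsing_inv _ hu, Matrix.one_mulVec]
  simp only [ellipsoid, mem_ofPred_eq]
  constructor
  · intro h
    have h1 := h (E⁻¹ *ᵥ x)
    rw [hx, dotProduct_comm] at h1
    nlinarith
  · intro h l
    have h0 := hE.posSemidef.dotProduct_mulVec_nonneg (l - (l ⬝ᵥ x) • (E⁻¹ *ᵥ x))
    have h2 := hsymm (E⁻¹ *ᵥ x) l
    rw [hx] at h2
    simp only [star_trivial, Matrix.mulVec_sub, Matrix.mulVec_smul, hx, dotProduct_sub,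
      sub_dotProduct, smul_dotProduct, dotProduct_smul, smul_eq_mul, h2] at h0
    rw [dotProduct_comm (E⁻¹ *ᵥ x) x] at h0
    nlinarith [sq_nonneg (l ⬝ᵥ x)]

/-- `μ` is central convex unimodal: it lies in the closed (for weak convergence) convex hull of the
uniform distributions on symmetric compact convex bodies. -/
def IsCentralConvexUnimodal {n : ℕ} (μ : ProbabilityMeasure (Fin n → ℝ)) : Prop :=
  μ.toFiniteMeasure ∈ closure (convexHull ℝ≥0
    {ν : FiniteMeasure (Fin n → ℝ) | ∃ C : Set (Fin n → ℝ),
      Convex ℝ C ∧ IsCompact C ∧ (interior C).Nonempty ∧ (∀ x ∈ C, -x ∈ C) ∧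
      (ν : Measure (Fin n → ℝ)) = ProbabilityTheory.cond volume C})

/-- The variance (covariance matrix) of a distribution on `ℝⁿ`. -/
noncomputable def varMatrix {n : ℕ} (μ : Measure (Fin n → ℝ)) : Matrix (Fin n) (Fin n) ℝ :=
  Matrix.of fun i j => covariance (fun x => x i) (fun x => x j) μ

/-- All (complex) eigenvalues lie strictly inside the unit circle. -/
def IsSchurStable {n : ℕ} (M : Matrix (Fin n) (Fin n) ℝ) : Prop :=
  ∀ c ∈ spectrum ℂ (M.map (algebraMap ℝ ℂ)), ‖c‖ < 1

/-- The constant `n / (1 - p)` of the multivariate Chebyshev inequality. -/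
noncomputable def chebyshevRadius (n : ℕ) (p : ℝ) : ℝ := n / (1 - p)

/-- The cumulative distribution function of the chi-squared distribution with `n` degrees of
freedom, i.e. of the sum of squares of `n` independent standard normal variables. -/
noncomputable def chiSquaredCDF (n : ℕ) (c : ℝ) : ℝ :=
  (Measure.pi fun _ : Fin n => gaussianReal 0 1).real {g | ∑ i, g i ^ 2 ≤ c}

/-- The inverse cumulative distribution function (quantile function) of the chi-squared
distribution with `n` degrees of freedom. -/
noncomputable def chiSquaredQuantile (n : ℕ) (p : ℝ) : ℝ :=
  sInf {c : ℝ | 0 ≤ c ∧ p ≤ chiSquaredCDF n c}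

/-- Extension by zero of a sequence of length `N`. -/
def extendZero {N : ℕ} (a : Fin N → ℝ) (k : ℕ) : ℝ :=
  if h : k < N then a ⟨k, h⟩ else 0

/-- The probability level that belongs to the scaled reachable set `(1 - a) R(pbar)`: the level
`p ∈ [0, pbar]` with `R(p) = (1 - a) R(pbar)`, and `0` if there is no such level. (The largest one
is taken where the level is not unique, which occurs only if the sets do not depend on it.) -/
noncomputable def levelOf {d : ℕ} (R : ℝ → Set (Fin d → ℝ)) (pbar a : ℝ) : ℝ :=
  sSup {p | p ∈ Icc 0 pbar ∧ R p = (1 - a) • R pbar}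

/-- The raw data of the stochastic control problem and of its tube-based reformulation with
state dimension `n` and input dimension `m`. -/
structure StochMPC (n m : ℕ) where
  /-- system matrix -/
  A : Matrix (Fin n) (Fin n) ℝ
  /-- input matrix -/
  B : Matrix (Fin n) (Fin m) ℝ
  /-- auxiliary feedback gain -/
  K : Matrix (Fin m) (Fin n) ℝ
  /-- steady-state error covariance, shape of the reachable sets -/
  Sig : Matrix (Fin n) (Fin n) ℝ
  /-- weight of the performance cost -/
  S : Matrix (Fin m) (Fin m) ℝ
  /-- state constraint set -/
  X : Set (Fin n → ℝ)
  /-- input constraint set -/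
  U : Set (Fin m → ℝ)
  /-- terminal set -/
  ZF : Set (Fin n → ℝ)
  /-- squared radius of the ellipsoidal reachable set as a function of the probability level -/
  rad : ℝ → ℝ
  /-- target lower bound for the state constraint -/
  pbarX : ℝ
  /-- target lower bound for the input constraint -/
  pbarU : ℝ
  /-- penalty on the initialization variable -/
  pen : ℝ → ℝ

namespace StochMPC

variable {n m N : ℕ} (M : StochMPC n m)

/-- The closed-loop matrix `A + B K`. -/
def AK : Matrix (Fin n) (Fin n) ℝ := M.A + M.B * M.K

/-- The ellipsoidal reachable set of level `p` for the error `e`. -/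
def reachX (p : ℝ) : Set (Fin n → ℝ) := ellipsoid (M.rad p • M.Sig)

/-- The ellipsoidal reachable set of level `p` for the input error `K e`. -/
def reachU (p : ℝ) : Set (Fin m → ℝ) := ellipsoid (M.rad p • (M.K * M.Sig * M.Kᵀ))

/-- The state constraint tightened with parameter `a`: `X ⊖ (1 - a) R_x`. -/
def tightX (a : ℝ) : Set (Fin n → ℝ) := pontryaginDiff M.X ((1 - a) • M.reachX M.pbarX)

/-- The input constraint tightened with parameter `b`: `U ⊖ (1 - b) R_u`. -/
def tightU (b : ℝ) : Set (Fin m → ℝ) := pontryaginDiff M.U ((1 - b) • M.reachU M.pbarU)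

/-- The nominal states `z_0, …, z_N` generated from `z_0 = z0` by `z_{i+1} = A z_i + B v_i`. -/
def nominal (z0 : Fin n → ℝ) (v : Fin N → Fin m → ℝ) : Fin (N + 1) → Fin n → ℝ :=
  Fin.induction (motive := fun _ => Fin n → ℝ) z0 fun i z => M.A *ᵥ z + M.B *ᵥ v i

/-- Feasibility of `(v, a, b)` for the safety step from the initial state `x0`. -/
def SafetyFeasible (x0 : Fin n → ℝ) (v : Fin N → Fin m → ℝ) (a b : Fin N → ℝ) : Prop :=
  (∀ i : Fin N, M.nominal x0 v i.castSucc ∈ M.tightX (a i) ∧ v i ∈ M.tightU (b i) ∧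
    a i ∈ Icc (0 : ℝ) 1 ∧ b i ∈ Icc (0 : ℝ) 1) ∧
  M.nominal x0 v (Fin.last N) ∈ M.ZF

/-- `(v, a, b)` is an optimal solution of the safety step. -/
def SafetyOptimal (x0 : Fin n → ℝ) (v : Fin N → Fin m → ℝ) (a b : Fin N → ℝ) : Prop :=
  M.SafetyFeasible x0 v a b ∧ ∀ v' : Fin N → Fin m → ℝ, ∀ a' b' : Fin N → ℝ,
    M.SafetyFeasible x0 v' a' b' → ∑ i, (a i + b i) ≤ ∑ i, (a' i + b' i)

/-- The initial nominal state `(1 - ξ) x + ξ z⁻`, where `z⁻` is the nominal state predicted at the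
previous time. -/
def initNominal (x zprev : Fin n → ℝ) (xi : ℝ) : Fin n → ℝ := (1 - xi) • x + xi • zprev

/-- Feasibility of `(v, ξ)` for the performance step at time `k`, with measured state `x`,
previously predicted nominal state `zprev`, and relaxation sequences `a`, `b`. -/
def PerfFeasible (a b : ℕ → ℝ) (k : ℕ) (x zprev : Fin n → ℝ)
    (d : (Fin N → Fin m → ℝ) × ℝ) : Prop :=
  (∀ i : Fin N, M.nominal (initNominal x zprev d.2) d.1 i.castSucc ∈ M.tightX (a (k + i)) ∧
    d.1 i ∈ M.tightU (b (k + i))) ∧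
  M.nominal (initNominal x zprev d.2) d.1 (Fin.last N) ∈ M.ZF ∧ (d.2 = 0 ∨ d.2 = 1)

/-- The cost `∑ ‖v_i - K z_i‖²_S + l(ξ)` of the performance step. -/
def perfCost (x zprev : Fin n → ℝ) (d : (Fin N → Fin m → ℝ) × ℝ) : ℝ :=
  (∑ i : Fin N,
    (d.1 i - M.K *ᵥ M.nominal (initNominal x zprev d.2) d.1 i.castSucc) ⬝ᵥ
      (M.S *ᵥ (d.1 i - M.K *ᵥ M.nominal (initNominal x zprev d.2) d.1 i.castSucc))) + M.pen d.2

/-- `d = (v, ξ)` is an optimal solution of the performance step. -/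
def PerfOptimal (a b : ℕ → ℝ) (k : ℕ) (x zprev : Fin n → ℝ)
    (d : (Fin N → Fin m → ℝ) × ℝ) : Prop :=
  M.PerfFeasible a b k x zprev d ∧ ∀ d' : (Fin N → Fin m → ℝ) × ℝ,
    M.PerfFeasible a b k x zprev d' → M.perfCost x zprev d ≤ M.perfCost x zprev d'

/-- The input `u = v_0 + K e`, `e = x - z_0`, applied for the decision `d = (v, ξ)`. -/
def applied [NeZero N] (x zprev : Fin n → ℝ) (d : (Fin N → Fin m → ℝ) × ℝ) : Fin m → ℝ :=
  d.1 0 + M.K *ᵥ (x - initNominal x zprev d.2)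

/-- The closed loop: the pair of the state `x(k)` and the nominal state `z_1(k-1)` predicted at time
`k - 1` (with the convention `z_1(-1) = x(0)`), where the decision at time `k` is
`π k x(k) z_1(k-1)` and `w` is the realized disturbance. -/
def loop [NeZero N] (π : ℕ → (Fin n → ℝ) → (Fin n → ℝ) → (Fin N → Fin m → ℝ) × ℝ)
    (x0 : Fin n → ℝ) (w : ℕ → Fin n → ℝ) : ℕ → (Fin n → ℝ) × (Fin n → ℝ)
  | 0 => (x0, x0)
  | k + 1 =>
    let x := (loop π x0 w k).1
    let zprev := (loop π x0 w k).2
    let d := π k x zprev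
    (M.A *ᵥ x + M.B *ᵥ M.applied x zprev d + w k,
      M.A *ᵥ initNominal x zprev d.2 + M.B *ᵥ d.1 0)

/-- The closed-loop state `x(k)`. -/
def state [NeZero N] (π : ℕ → (Fin n → ℝ) → (Fin n → ℝ) → (Fin N → Fin m → ℝ) × ℝ)
    (x0 : Fin n → ℝ) (w : ℕ → Fin n → ℝ) (k : ℕ) : Fin n → ℝ :=
  (M.loop π x0 w k).1

/-- The closed-loop input `u(k)`. -/
def input [NeZero N] (π : ℕ → (Fin n → ℝ) → (Fin n → ℝ) → (Fin N → Fin m → ℝ) × ℝ)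
    (x0 : Fin n → ℝ) (w : ℕ → Fin n → ℝ) (k : ℕ) : Fin m → ℝ :=
  M.applied (M.loop π x0 w k).1 (M.loop π x0 w k).2
    (π k (M.loop π x0 w k).1 (M.loop π x0 w k).2)

end StochMPC

open scoped ENNReal Topology
open Filter

/-! Let `e k` be the error between the state and the predicted nominal state at time `k`, and `r k`
the error after the initialization. Choosing `ξ = 0` resets the error to zero and `ξ = 1` keeps it,
so `r k` is `0` or `e k`, and `e (k + 1) = A_K r k + w k`. The resets depend on the past through the
optimizer, so the law of `r k` is not explicit. It is compared with the law of the never-reset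
error, a sum of independent terms `A_K ^ i w_i`.

The comparison rests on unimodality: moving an even log-concave function off the origin cannot
increase its integral against such a sum (`IsPeaked`). For a uniform law on a symmetric convex body
this follows from Prékopa–Leindler, because averaging over the body preserves even log-concavity;
weakly closed convex hulls inherit it, since the comparison is between integrals of bounded
continuous functions. A reset therefore only increases the expected value of an even log-concave
function of the error, whatever event triggers it. Resets are replaced one at a time by induction
(`integral_noiseSumLaw_add_le`), and the functions `exp (-m dist(·, C))` carry the result to closed
symmetric convex sets, in particular to ellipsoids.

For the never-reset error, each covariance is dominated by the Lyapunov solution, so Chebyshev, or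
the chi-squared law in the Gaussian case, gives the reachable set of level `p` probability at least
`p`. Finally, shifting the previous plan and appending the terminal feedback keeps the performance
step feasible. Hence `z_0` always lies in the tightened set, and the constraint holds whenever the
error lies in the reachable set. -/

/-! ### Brunn–Minkowski and Prékopa–Leindler inequalities -/

/-- One-dimensional Brunn–Minkowski inequality for compact sets. -/
theorem IsCompact.volume_add_volume_le {A B : Set ℝ} (hA : IsCompact A) (hB : IsCompact B)
    (hA' : A.Nonempty) (hB' : B.Nonempty) : volume A + volume B ≤ volume (A + B) := by
  have ha := hA.sSup_mem hA'
  have hb := hB.sInf_mem hB'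
  set a := sSup A
  set b := sInf B
  -- With `a` the maximum of `A` and `b` the minimum of `B`, these two translates lie on either side
  -- of `a + b` and meet only there.
  have hsub : (A + {b}) ∪ ({a} + B) ⊆ A + B :=
    union_subset (add_subset_add_left (by simpa using hb))
      (add_subset_add_right (by simpa using ha))
  have hinter : (A + {b}) ∩ ({a} + B) ⊆ {a + b} := by
    rintro _ ⟨⟨x, hx, y, hy, rfl⟩, ⟨x', hx', y', hy', h⟩⟩
    simp only [mem_singleton_iff] at hy hx' h ⊢
    subst hy hx'
    have h1 : x ≤ a := le_csSup hA.bddAbove hx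
    have h2 : b ≤ y' := csInf_le hB.bddBelow hy'
    linarith
  calc volume A + volume B = volume (A + {b}) + volume ({a} + B) := by
        simp [add_singleton, singleton_add]
    _ = volume ((A + {b}) ∪ ({a} + B)) := by
        rw [measure_union₀ ((isCompact_singleton.add hB).measurableSet.nullMeasurableSet)]
        exact measure_mono_null hinter (by simp)
    _ ≤ volume (A + B) := measure_mono hsub

/-- One-dimensional Brunn–Minkowski inequality for measurable sets. -/
theorem MeasurableSet.volume_add_volume_le {A B : Set ℝ} (hA : MeasurableSet A)
    (hB : MeasurableSet B) (hA' : A.Nonempty) (hB' : B.Nonempty) :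
    volume A + volume B ≤ volume (A + B) := by
  obtain ⟨a, ha⟩ := hA'
  obtain ⟨b, hb⟩ := hB'
  have key : ∀ S ⊆ A, ∀ T ⊆ B, IsCompact S → IsCompact T →
      volume S + volume T ≤ volume (A + B) := by
    intro S hS T hT hSc hTc
    -- The approximating compact sets may be empty; adjoining a point of `A` or `B` makes the
    -- compact case applicable.
    have h := (hSc.insert a).volume_add_volume_le (hTc.insert b) (insert_nonempty _ _)
      (insert_nonempty _ _)
    refine le_trans (add_le_add (measure_mono (subset_insert _ _))
      (measure_mono (subset_insert _ _))) (h.trans (measure_mono ?_))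
    exact add_subset_add (insert_subset ha hS) (insert_subset hb hT)
  rw [hA.measure_eq_iSup_isCompact, hB.measure_eq_iSup_isCompact]
  simp only [iSup_and']
  exact ENNReal.biSup_add_biSup_le' ⟨∅, by simp⟩ ⟨∅, by simp⟩
    fun S hS T hT => key S hS.1 T hT.1 hS.2 hT.2

/-- The arithmetic–geometric mean inequality, which turns the additive form of Prékopa–Leindler into
the multiplicative one. -/
theorem ENNReal.mul_le_sq_of_add_le_two_mul {a b c : ℝ≥0∞} (h : a + b ≤ 2 * c) :
    a * b ≤ c ^ 2 := by
  rcases eq_or_ne c ⊤ with rfl | hc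
  · simp
  have hab : a + b ≠ ⊤ := ne_top_of_le_ne_top (ENNReal.mul_ne_top (by simp) hc) h
  lift c to ℝ≥0 using hc
  lift a to ℝ≥0 using fun ha => hab (by simp [ha])
  lift b to ℝ≥0 using fun hb => hab (by simp [hb])
  norm_cast at h ⊢
  have h' : (a : ℝ) + b ≤ 2 * c := by exact_mod_cast h
  have : (a : ℝ) * b ≤ c ^ 2 := by
    nlinarith [sq_nonneg ((a : ℝ) - b), a.coe_nonneg, b.coe_nonneg, c.coe_nonneg]
  exact_mod_cast this

/-- The additive form of the one-dimensional Prékopa–Leindler inequality for functions with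
supremum one. -/
theorem lintegral_add_lintegral_le_of_midpoint {f g h : ℝ → ℝ} (hf : Measurable f)
    (hg : Measurable g) (hh : Measurable h) (hf0 : 0 ≤ f) (hg0 : 0 ≤ g) (hh0 : 0 ≤ h)
    (hf1 : f ≤ 1) (hg1 : g ≤ 1) (hfs : ∀ t < 1, ∃ x, t < f x) (hgs : ∀ t < 1, ∃ x, t < g x)
    (hmid : ∀ x y, f x * g y ≤ h ((2⁻¹ : ℝ) • (x + y)) ^ 2) :
    (∫⁻ x, ENNReal.ofReal (f x)) + (∫⁻ x, ENNReal.ofReal (g x)) ≤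
      2 * ∫⁻ x, ENNReal.ofReal (h x) := by
  rw [lintegral_eq_lintegral_meas_lt _ (ae_of_all _ hf0) hf.aemeasurable,
    lintegral_eq_lintegral_meas_lt _ (ae_of_all _ hg0) hg.aemeasurable,
    lintegral_eq_lintegral_meas_lt _ (ae_of_all _ hh0) hh.aemeasurable]
  have hanti : ∀ u : ℝ → ℝ, Antitone fun t : ℝ => volume {x | t < u x} :=
    fun u s t hst => measure_mono fun x hx => lt_of_le_of_lt hst hx
  rw [← lintegral_add_left (hanti f).measurable, ← lintegral_const_mul _ (hanti h).measurable]
  refine setLIntegral_mono ((hanti h).measurable.const_mul 2) fun t ht => ?_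
  rcases lt_or_ge t 1 with ht1 | ht1
  · refine (MeasurableSet.volume_add_volume_le (measurableSet_lt measurable_const hf)
      (measurableSet_lt measurable_const hg) (hfs t ht1) (hgs t ht1)).trans ?_
    -- Brunn–Minkowski is applied to superlevel sets: if `f x > t` and `g y > t`, then `h > t` at
    -- the midpoint, so the sum of the two sets lies in twice that of `h`. The supremum hypotheses
    -- keep both sets nonempty for `t < 1`; for `t ≥ 1` they are empty.
    have hvol : 2 * volume {x | t < h x} = volume ((2 : ℝ) • {x | t < h x}) := by
      rw [Measure.addHaar_smul]; simp
    rw [hvol]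
    refine measure_mono ?_
    rintro _ ⟨x, hx, y, hy, rfl⟩
    refine ⟨(2⁻¹ : ℝ) • (x + y), ?_, by simp⟩
    have h1 : t * t < f x * g y := mul_lt_mul'' hx hy (le_of_lt ht) (le_of_lt ht)
    have h2 := hmid x y
    have h3 : 0 ≤ h ((2⁻¹ : ℝ) • (x + y)) := hh0 _
    simp only [mem_ofPred_eq]
    by_contra hcon
    push Not at hcon
    have := mul_le_mul hcon hcon h3 (le_of_lt ht)
    nlinarith
  · have : ∀ u : ℝ → ℝ, u ≤ 1 → {x | t < u x} = ∅ := fun u hu => by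
      ext x
      simpa using (hu x).trans ht1
    simp [this f hf1, this g hg1]

/-- A measure satisfies the midpoint Prékopa–Leindler inequality. -/
def MidpointPrekopaLeindler {E : Type*} [AddCommGroup E] [Module ℝ E] [MeasurableSpace E]
    (μ : Measure E) : Prop :=
  ∀ f g h : E → ℝ≥0∞, Measurable f → Measurable g → Measurable h →
    (∀ x y, f x * g y ≤ h ((2⁻¹ : ℝ) • (x + y)) ^ 2) →
    (∫⁻ x, f x ∂μ) * (∫⁻ x, g x ∂μ) ≤ (∫⁻ x, h x ∂μ) ^ 2

/-- Dividing `f` and `g` by their suprema makes both suprema one, so that the additive form applies;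
the product inequality is homogeneous and scales back. -/
theorem midpointPrekopaLeindler_real_of_bounded {f g h : ℝ → ℝ≥0∞} (hf : Measurable f)
    (hg : Measurable g) (hh : Measurable h) (hfb : ⨆ x, f x ≠ ⊤) (hgb : ⨆ x, g x ≠ ⊤)
    (hmid : ∀ x y, f x * g y ≤ h ((2⁻¹ : ℝ) • (x + y)) ^ 2) :
    (∫⁻ x, f x) * (∫⁻ x, g x) ≤ (∫⁻ x, h x) ^ 2 := by
  have hfa : ∀ x, f x ≤ ⨆ x, f x := le_iSup f
  have hgb' : ∀ x, g x ≤ ⨆ x, g x := le_iSup g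
  set a := ⨆ x, f x with ha
  set b := ⨆ x, g x with hb
  rcases eq_or_ne a 0 with ha0 | ha0
  · have : f = 0 := funext fun x => by simpa [ha0] using hfa x
    simp [this]
  rcases eq_or_ne b 0 with hb0 | hb0
  · have : g = 0 := funext fun x => by simpa [hb0] using hgb' x
    simp [this]
  set c : ℝ≥0∞ := (a * b) ^ (1 / 2 : ℝ) with hc
  have hc2 : c ^ 2 = a * b := by
    rw [hc, ← ENNReal.rpow_natCast, ← ENNReal.rpow_mul]; norm_num
  have hab : a * b ≠ 0 := mul_ne_zero ha0 hb0
  have hab' : a * b ≠ ⊤ := ENNReal.mul_ne_top hfb hgb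
  have hc0 : c ≠ 0 := fun h0 => hab (by rw [← hc2, h0]; simp)
  have hct : c ≠ ⊤ := fun h0 => hab' (by rw [← hc2, h0]; simp)
  have hdiv : ∀ (u : ℝ → ℝ≥0∞) (d : ℝ≥0∞), d ≠ 0 → d ≠ ⊤ → (∀ x, u x ≤ d) →
      ∀ x, u x / d ≤ 1 := fun u d h0 ht hu x => by
    rw [ENNReal.div_le_iff h0 ht, one_mul]; exact hu x
  have hsup : ∀ (u : ℝ → ℝ≥0∞) (d : ℝ≥0∞), d ≠ 0 → d ≠ ⊤ → d = ⨆ x, u x → (∀ x, u x ≤ d) →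
      ∀ t < (1 : ℝ), ∃ x, t < (u x / d).toReal := fun u d h0 ht hd hu t ht1 => by
    have h1 : ENNReal.ofReal t < 1 := by
      rwa [← ENNReal.ofReal_one, ENNReal.ofReal_lt_ofReal_iff one_pos]
    have h2 : ENNReal.ofReal t * d < ⨆ x, u x := by
      rw [← hd]
      calc ENNReal.ofReal t * d < 1 * d := (ENNReal.mul_lt_mul_iff_left h0 ht).2 h1
        _ = d := one_mul d
    obtain ⟨x, hx⟩ := lt_iSup_iff.1 h2
    refine ⟨x, ?_⟩
    have h3 : ENNReal.ofReal t < u x / d := by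
      rwa [ENNReal.lt_div_iff_mul_lt (Or.inl h0) (Or.inl ht)]
    have h4 : u x / d ≠ ⊤ := ne_top_of_le_ne_top ENNReal.one_ne_top (hdiv u d h0 ht hu x)
    rw [← ENNReal.ofReal_toReal h4] at h3
    exact lt_of_not_ge fun hcon => absurd h3 (not_lt.2 (ENNReal.ofReal_le_ofReal hcon))
  have hofReal : ∀ (u : ℝ → ℝ≥0∞) (d : ℝ≥0∞), d ≠ 0 → d ≠ ⊤ → (∀ x, u x ≤ d) →
      ∫⁻ x, ENNReal.ofReal (u x / d).toReal = (∫⁻ x, u x) / d := fun u d h0 ht hu => by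
    rw [div_eq_mul_inv, ← lintegral_mul_const' _ _ (by simpa using h0)]
    refine lintegral_congr fun x => ?_
    rw [ENNReal.ofReal_toReal (ne_top_of_le_ne_top ENNReal.one_ne_top (hdiv u d h0 ht hu x)),
      div_eq_mul_inv]
  -- Capping `h` at `c = √(ab)` makes it finite without losing the midpoint hypothesis, since `f x *
  -- g y ≤ a * b = c ^ 2`.
  have hhc : ∀ x, min (h x) c ≤ c := fun x => min_le_right _ _
  have key := lintegral_add_lintegral_le_of_midpoint
    (f := fun x => (f x / a).toReal) (g := fun x => (g x / b).toReal)
    (h := fun x => (min (h x) c / c).toReal) (hf.div_const a).ennreal_toReal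
    (hg.div_const b).ennreal_toReal ((hh.min measurable_const).div_const c).ennreal_toReal
    (fun _ => ENNReal.toReal_nonneg) (fun _ => ENNReal.toReal_nonneg)
    (fun _ => ENNReal.toReal_nonneg)
    (fun x => ENNReal.toReal_le_of_le_ofReal zero_le_one (by simpa using hdiv f a ha0 hfb hfa x))
    (fun x => ENNReal.toReal_le_of_le_ofReal zero_le_one (by simpa using hdiv g b hb0 hgb hgb' x))
    (hsup f a ha0 hfb ha hfa) (hsup g b hb0 hgb hb hgb') (fun x y => by
      rw [← ENNReal.toReal_mul, ← ENNReal.toReal_pow]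
      refine ENNReal.toReal_mono (ENNReal.pow_ne_top (ne_top_of_le_ne_top ENNReal.one_ne_top
        (hdiv _ c hc0 hct hhc _))) ?_
      have e1 : f x / a * (g y / b) = f x * g y / c ^ 2 := by
        rw [hc2, div_eq_mul_inv, div_eq_mul_inv, div_eq_mul_inv,
          ENNReal.mul_inv (Or.inl ha0) (Or.inl hfb)]
        ring
      have e2 : (min (h ((2⁻¹ : ℝ) • (x + y))) c / c) ^ 2 =
          min (h ((2⁻¹ : ℝ) • (x + y))) c ^ 2 / c ^ 2 := by
        rw [div_eq_mul_inv, mul_pow, ← ENNReal.inv_pow, div_eq_mul_inv]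
      rw [e1, e2]
      gcongr
      rcases min_cases (h ((2⁻¹ : ℝ) • (x + y))) c with h' | h'
      · rw [h'.1]; exact hmid x y
      · rw [h'.1, hc2]; exact mul_le_mul' (hfa x) (hgb' y))
  rw [hofReal f a ha0 hfb hfa, hofReal g b hb0 hgb hgb', hofReal _ c hc0 hct hhc] at key
  have key2 := ENNReal.mul_le_sq_of_add_le_two_mul key
  have hmin : ∫⁻ x, min (h x) c ≤ ∫⁻ x, h x := lintegral_mono fun x => min_le_left _ _
  have e1 : (∫⁻ x, f x) / a * ((∫⁻ x, g x) / b) = (∫⁻ x, f x) * (∫⁻ x, g x) / c ^ 2 := by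
    rw [hc2, div_eq_mul_inv, div_eq_mul_inv, div_eq_mul_inv,
      ENNReal.mul_inv (Or.inl ha0) (Or.inl hfb)]
    ring
  rw [e1, div_eq_mul_inv _ c, mul_pow, ← ENNReal.inv_pow, ← div_eq_mul_inv] at key2
  have hc20 : c ^ 2 ≠ 0 := pow_ne_zero 2 hc0
  have hc2t : c ^ 2 ≠ ⊤ := ENNReal.pow_ne_top hct
  rw [ENNReal.div_le_iff hc20 hc2t, ENNReal.div_mul_cancel hc20 hc2t] at key2
  exact key2.trans (pow_le_pow_left' hmin 2)

/-- The one-dimensional Prékopa–Leindler inequality. -/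
theorem midpointPrekopaLeindler_real : MidpointPrekopaLeindler (volume : Measure ℝ) := by
  intro f g h hf hg hh hmid
  -- Monotone convergence along truncations reduces to bounded `f` and `g`; `h` stays as it is.
  have htr : ∀ u : ℝ → ℝ≥0∞, Measurable u →
      ∫⁻ x, u x = ⨆ k : ℕ, ∫⁻ x, min (u x) k := fun u hu => by
    rw [← lintegral_iSup (fun k => hu.min measurable_const)
      (fun i j hij x => min_le_min_left _ (by exact_mod_cast hij))]
    refine lintegral_congr fun x => ?_
    have : ⨆ k : ℕ, min (u x) k = u x ⊓ ⨆ k : ℕ, (k : ℝ≥0∞) := by rw [inf_iSup_eq]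
    rw [this, ENNReal.iSup_natCast]; simp
  rw [htr f hf, htr g hg]
  simp only [ENNReal.iSup_mul, ENNReal.mul_iSup, iSup_le_iff]
  intro i j
  have hb : ∀ (u : ℝ → ℝ≥0∞) (k : ℕ), ⨆ x, min (u x) k ≠ ⊤ := fun u k =>
    ne_top_of_le_ne_top (ENNReal.natCast_ne_top k) (iSup_le fun x => min_le_right _ _)
  exact midpointPrekopaLeindler_real_of_bounded (hf.min measurable_const)
    (hg.min measurable_const) hh (hb _ _) (hb _ _)
    fun x y => (mul_le_mul' (min_le_left _ _) (min_le_left _ _)).trans (hmid x y)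

/-- Tensorization: by the inequality for `ν`, the integrals over the second variable satisfy the
midpoint hypothesis in the first variable. -/
theorem MidpointPrekopaLeindler.prod {E F : Type*} [AddCommGroup E] [Module ℝ E]
    [MeasurableSpace E] [AddCommGroup F] [Module ℝ F] [MeasurableSpace F] {μ : Measure E}
    {ν : Measure F} [SFinite ν] (hμ : MidpointPrekopaLeindler μ)
    (hν : MidpointPrekopaLeindler ν) : MidpointPrekopaLeindler (μ.prod ν) := by
  intro f g h hf hg hh hmid
  rw [lintegral_prod _ hf.aemeasurable, lintegral_prod _ hg.aemeasurable,
    lintegral_prod _ hh.aemeasurable]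
  refine hμ _ _ _ hf.lintegral_prod_right' hg.lintegral_prod_right' hh.lintegral_prod_right'
    fun x y => ?_
  exact hν _ _ _ (hf.comp measurable_prodMk_left) (hg.comp measurable_prodMk_left)
    (hh.comp measurable_prodMk_left) fun x' y' => hmid (x, x') (y, y')

theorem MidpointPrekopaLeindler.of_measurePreserving {E F : Type*} [AddCommGroup E] [Module ℝ E]
    [MeasurableSpace E] [AddCommGroup F] [Module ℝ F] [MeasurableSpace F] {μ : Measure E}
    {ν : Measure F} (hμ : MidpointPrekopaLeindler μ) {e : E → F} (he : MeasurePreserving e μ ν)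
    (hadd : ∀ x y, e ((2⁻¹ : ℝ) • (x + y)) = (2⁻¹ : ℝ) • (e x + e y)) :
    MidpointPrekopaLeindler ν := by
  intro f g h hf hg hh hmid
  rw [← he.lintegral_comp hf, ← he.lintegral_comp hg, ← he.lintegral_comp hh]
  exact hμ _ _ _ (hf.comp he.measurable) (hg.comp he.measurable) (hh.comp he.measurable)
    fun x y => by rw [hadd]; exact hmid _ _

/-- The midpoint Prékopa–Leindler inequality on `ℝⁿ`. -/
theorem midpointPrekopaLeindler_pi :
    ∀ n : ℕ, MidpointPrekopaLeindler (volume : Measure (Fin n → ℝ))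
  | 0 => by
    intro f g h hf hg hh hmid
    rw [volume_pi, Measure.pi_of_empty (x := 0), lintegral_dirac, lintegral_dirac, lintegral_dirac]
    simpa only [Subsingleton.elim ((2⁻¹ : ℝ) • (0 + 0) : Fin 0 → ℝ) 0] using hmid 0 0
  | n + 1 => by
    refine (midpointPrekopaLeindler_real.prod (midpointPrekopaLeindler_pi n)).of_measurePreserving
      (volume_preserving_piFinSuccAbove (fun _ : Fin (n + 1) => ℝ) 0).symm fun x y => ?_
    ext i
    refine Fin.cases ?_ (fun j => ?_) i <;> simp [MeasurableEquiv.piFinSuccAbove, mul_add]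

/-! ### Even log-concave functions and peakedness of unimodal noise -/

/-- Continuous even midpoint log-concave functions with values in `[0, 1]`. -/
structure IsEvenLogConcave {n : ℕ} (f : (Fin n → ℝ) → ℝ) : Prop where
  continuous : Continuous f
  nonneg : ∀ x, 0 ≤ f x
  le_one : ∀ x, f x ≤ 1
  even : ∀ x, f (-x) = f x
  mul_le : ∀ x y, f x * f y ≤ f ((2⁻¹ : ℝ) • (x + y)) ^ 2

namespace IsEvenLogConcave

variable {n : ℕ} {f : (Fin n → ℝ) → ℝ}

theorem le_zero (hf : IsEvenLogConcave f) (a : Fin n → ℝ) : f a ≤ f 0 := by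
  have h := hf.mul_le a (-a)
  rw [hf.even, add_neg_cancel, smul_zero] at h
  nlinarith [hf.nonneg a, hf.nonneg 0]

theorem norm_le (hf : IsEvenLogConcave f) (x : Fin n → ℝ) : ‖f x‖ ≤ 1 := by
  rw [Real.norm_of_nonneg (hf.nonneg x)]; exact hf.le_one x

theorem integrable_comp (hf : IsEvenLogConcave f) {α : Type*} [MeasurableSpace α] {ν : Measure α}
    [IsFiniteMeasure ν] {u : α → Fin n → ℝ} (hu : Measurable u) :
    Integrable (fun x => f (u x)) ν :=
  Integrable.of_bound (hf.continuous.measurable.comp hu).aestronglyMeasurable 1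
    (ae_of_all _ fun _ => hf.norm_le _)

theorem integral_comp_nonneg (hf : IsEvenLogConcave f) {α : Type*} [MeasurableSpace α]
    {ν : Measure α} {u : α → Fin n → ℝ} : 0 ≤ ∫ x, f (u x) ∂ν :=
  integral_nonneg fun _ => hf.nonneg _

theorem integral_comp_le_one (hf : IsEvenLogConcave f) {α : Type*} [MeasurableSpace α]
    {ν : Measure α} [IsProbabilityMeasure ν] {u : α → Fin n → ℝ} (hu : Measurable u) :
    ∫ x, f (u x) ∂ν ≤ 1 := by
  calc ∫ x, f (u x) ∂ν ≤ ∫ _, (1 : ℝ) ∂ν :=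
        integral_mono (hf.integrable_comp hu) (integrable_const _) fun _ => hf.le_one _
    _ = 1 := by simp

theorem continuous_integral_add (hf : IsEvenLogConcave f) {α : Type*} [MeasurableSpace α]
    {ν : Measure α} [IsFiniteMeasure ν] {u : α → Fin n → ℝ} (hu : Measurable u) :
    Continuous fun y => ∫ x, f (y + u x) ∂ν :=
  continuous_of_dominated
    (fun _ => (hf.continuous.measurable.comp (measurable_const.add hu)).aestronglyMeasurable)
    (fun _ => ae_of_all _ fun _ => hf.norm_le _) (integrable_const 1)
    (ae_of_all _ fun _ => hf.continuous.comp (continuous_id.add continuous_const))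

/-- Averaging over the linear image of a symmetric convex body preserves even log-concavity. -/
theorem integral_cond (hf : IsEvenLogConcave f) {C : Set (Fin n → ℝ)} (hC : Convex ℝ C)
    (hCc : IsCompact C) (hCi : (interior C).Nonempty) (hCs : ∀ x ∈ C, -x ∈ C)
    (M : Matrix (Fin n) (Fin n) ℝ) :
    IsEvenLogConcave fun y => ∫ x, f (y + M *ᵥ x) ∂(ProbabilityTheory.cond volume C) := by
  have hC0 : volume C ≠ 0 := (Measure.measure_pos_of_nonempty_interior volume hCi).ne'
  have hCt : volume C ≠ ⊤ := hCc.measure_lt_top.ne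
  have : IsProbabilityMeasure (ProbabilityTheory.cond volume C) :=
    cond_isProbabilityMeasure_of_finite hC0 hCt
  have hM : Continuous fun x => M *ᵥ x := by fun_prop
  have hMy : ∀ y, Measurable fun x => y + M *ᵥ x := fun y => by fun_prop
  refine ⟨hf.continuous_integral_add hM.measurable, fun _ => hf.integral_comp_nonneg,
    fun y => hf.integral_comp_le_one (hMy y), fun y => ?_, fun y z => ?_⟩
  · have hCneg : -C = C := by
      ext x
      exact ⟨fun hx => by simpa using hCs _ hx, fun hx => hCs x hx⟩
    simp only [ProbabilityTheory.cond, integral_smul_measure]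
    congr 1
    have hmp : MeasurePreserving (fun x : Fin n → ℝ => -x) (volume.restrict C)
        (volume.restrict C) := by
      have := (Measure.measurePreserving_neg (volume : Measure (Fin n → ℝ))).restrict_preimage
        hCc.measurableSet
      rwa [show Neg.neg ⁻¹' C = C from hCneg] at this
    -- Evenness: the substitution `x ↦ -x` preserves the uniform law on the symmetric body.
    rw [← hmp.integral_comp (MeasurableEquiv.neg _).measurableEmbedding]
    refine integral_congr_ae (ae_of_all _ fun x => ?_)
    simp only [Matrix.mulVec_neg]
    rw [← neg_add, hf.even]
  · have hof : ∀ y, ENNReal.ofReal (∫ x, f (y + M *ᵥ x) ∂(ProbabilityTheory.cond volume C)) =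
        (volume C)⁻¹ * ∫⁻ x, C.indicator (fun x => ENNReal.ofReal (f (y + M *ᵥ x))) x := fun y => by
      rw [ofReal_integral_eq_lintegral_ofReal (hf.integrable_comp (hMy y))
        (ae_of_all _ fun _ => hf.nonneg _), lintegral_indicator hCc.measurableSet,
        ProbabilityTheory.cond, lintegral_smul_measure, smul_eq_mul]
    have hmeas : ∀ y, Measurable (C.indicator fun x => ENNReal.ofReal (f (y + M *ᵥ x))) := fun y =>
      (hf.continuous.measurable.comp (hMy y)).ennreal_ofReal.indicator hCc.measurableSet
    -- Prékopa–Leindler for `x ↦ 1_C(x) f(y + M x)`, integrated over `C` itself rather than its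
    -- image, so that `M` may be singular.
    have key := midpointPrekopaLeindler_pi n _ _ _ (hmeas y) (hmeas z)
      (hmeas ((2⁻¹ : ℝ) • (y + z))) fun x x' => by
        by_cases hx : x ∈ C
        · by_cases hx' : x' ∈ C
          · have hmem : (2⁻¹ : ℝ) • (x + x') ∈ C := by
              rw [smul_add]
              exact hC hx hx' (by norm_num) (by norm_num) (by norm_num)
            rw [indicator_of_mem hx, indicator_of_mem hx', indicator_of_mem hmem,
              ← ENNReal.ofReal_mul (hf.nonneg _), ← ENNReal.ofReal_pow (hf.nonneg _)]
            refine ENNReal.ofReal_le_ofReal ((hf.mul_le _ _).trans_eq ?_)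
            congr 2
            rw [Matrix.mulVec_smul, Matrix.mulVec_add]
            module
          · simp [hx']
        · simp [hx]
    have h2 : ENNReal.ofReal ((∫ x, f (y + M *ᵥ x) ∂(ProbabilityTheory.cond volume C)) *
        ∫ x, f (z + M *ᵥ x) ∂(ProbabilityTheory.cond volume C)) ≤
        ENNReal.ofReal ((∫ x, f ((2⁻¹ : ℝ) • (y + z) + M *ᵥ x)
          ∂(ProbabilityTheory.cond volume C)) ^ 2) := by
      rw [ENNReal.ofReal_mul hf.integral_comp_nonneg, ENNReal.ofReal_pow hf.integral_comp_nonneg,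
        hof, hof, hof, mul_pow, sq (volume C)⁻¹, mul_mul_mul_comm]
      exact mul_le_mul_right key _
    exact (ENNReal.ofReal_le_ofReal_iff (sq_nonneg _)).1 h2

end IsEvenLogConcave

/-- A measure for which shifting never increases the integral of an even log-concave function. -/
def IsPeaked {n : ℕ} (ρ : Measure (Fin n → ℝ)) : Prop :=
  ∀ f : (Fin n → ℝ) → ℝ, IsEvenLogConcave f → ∀ a, ∫ s, f (a + s) ∂ρ ≤ ∫ s, f s ∂ρ

theorem isPeaked_dirac_zero {n : ℕ} : IsPeaked (Measure.dirac (0 : Fin n → ℝ)) := by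
  intro f hf a
  simpa using hf.le_zero a

theorem MeasureTheory.FiniteMeasure.continuous_integral {E : Type*} [TopologicalSpace E]
    [MeasurableSpace E] [OpensMeasurableSpace E] (g : BoundedContinuousFunction E ℝ) :
    Continuous fun ν : FiniteMeasure E => ∫ x, g x ∂(ν : Measure E) :=
  continuous_iff_continuousAt.2 fun _ =>
    FiniteMeasure.tendsto_iff_forall_integral_tendsto.1 tendsto_id g

/-- An inequality between integrals of bounded continuous functions passes from the uniform
distributions on symmetric convex bodies to all central convex unimodal distributions. -/
theorem IsCentralConvexUnimodal.integral_le_integral {n : ℕ}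
    {Q : ProbabilityMeasure (Fin n → ℝ)} (hQ : IsCentralConvexUnimodal Q)
    (g₁ g₂ : BoundedContinuousFunction (Fin n → ℝ) ℝ)
    (h : ∀ C : Set (Fin n → ℝ), Convex ℝ C → IsCompact C → (interior C).Nonempty →
      (∀ x ∈ C, -x ∈ C) → ∫ x, g₁ x ∂(ProbabilityTheory.cond volume C) ≤
        ∫ x, g₂ x ∂(ProbabilityTheory.cond volume C)) :
    ∫ x, g₁ x ∂(Q : Measure (Fin n → ℝ)) ≤ ∫ x, g₂ x ∂(Q : Measure (Fin n → ℝ)) := by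
  -- The inequality cuts out a convex, weakly closed set of measures; it contains the generators,
  -- hence the closed hull.
  set S : Set (FiniteMeasure (Fin n → ℝ)) :=
    {ν | ∫ x, g₁ x ∂(ν : Measure (Fin n → ℝ)) ≤ ∫ x, g₂ x ∂(ν : Measure (Fin n → ℝ))} with hS
  have hclosed : IsClosed S :=
    isClosed_le (FiniteMeasure.continuous_integral g₁) (FiniteMeasure.continuous_integral g₂)
  have hconv : Convex ℝ≥0 S := by
    intro ν hν ν' hν' s t _ _ _
    have hint : ∀ g : BoundedContinuousFunction (Fin n → ℝ) ℝ,
        ∫ x, g x ∂((s • ν + t • ν' : FiniteMeasure (Fin n → ℝ)) : Measure (Fin n → ℝ)) =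
          s * ∫ x, g x ∂(ν : Measure (Fin n → ℝ)) + t * ∫ x, g x ∂(ν' : Measure (Fin n → ℝ)) := by
      intro g
      rw [FiniteMeasure.toMeasure_add, integral_add_measure (g.integrable _) (g.integrable _),
        FiniteMeasure.toMeasure_smul, FiniteMeasure.toMeasure_smul, integral_smul_nnreal_measure,
        integral_smul_nnreal_measure]
      rfl
    simp only [hS, mem_ofPred_eq, hint] at hν hν' ⊢
    gcongr
  have hsub : {ν : FiniteMeasure (Fin n → ℝ) | ∃ C : Set (Fin n → ℝ),
      Convex ℝ C ∧ IsCompact C ∧ (interior C).Nonempty ∧ (∀ x ∈ C, -x ∈ C) ∧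
      (ν : Measure (Fin n → ℝ)) = ProbabilityTheory.cond volume C} ⊆ S := by
    rintro ν ⟨C, h1, h2, h3, h4, h5⟩
    simp only [hS, mem_ofPred_eq, h5]
    exact h C h1 h2 h3 h4
  exact closure_minimal (convexHull_min hsub hconv) hclosed hQ

/-- Adding an independent linear image of a central convex unimodal vector preserves
peakedness. -/
theorem IsPeaked.map_add_mulVec {n : ℕ} {ρ : Measure (Fin n → ℝ)} [IsProbabilityMeasure ρ]
    (hρ : IsPeaked ρ) {Q : ProbabilityMeasure (Fin n → ℝ)} (hQ : IsCentralConvexUnimodal Q)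
    (M : Matrix (Fin n) (Fin n) ℝ) :
    IsPeaked ((ρ.prod (Q : Measure (Fin n → ℝ))).map fun p => p.1 + M *ᵥ p.2) := by
  intro f hf a
  have hmeas : Measurable fun p : (Fin n → ℝ) × (Fin n → ℝ) => p.1 + M *ᵥ p.2 := by fun_prop
  have hmeasa : ∀ a, Measurable fun p : (Fin n → ℝ) × (Fin n → ℝ) => a + (p.1 + M *ᵥ p.2) :=
    fun a => by fun_prop
  have hG : Continuous fun y => ∫ s, f (y + s) ∂ρ := hf.continuous_integral_add measurable_id
  -- Integrating out `ρ` first leaves a bounded continuous function of the noise alone, as the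
  -- reduction to uniform laws requires. For a uniform law the order is then reversed: averaging
  -- over the body gives an even log-concave function, to which peakedness of `ρ` applies.
  let G : (Fin n → ℝ) → BoundedContinuousFunction (Fin n → ℝ) ℝ := fun a =>
    BoundedContinuousFunction.ofNormedAddCommGroup (fun x => ∫ s, f (a + M *ᵥ x + s) ∂ρ)
      (hG.comp (by fun_prop : Continuous fun x => a + M *ᵥ x)) 1 fun x => by
        rw [Real.norm_of_nonneg hf.integral_comp_nonneg]
        exact hf.integral_comp_le_one (by fun_prop)
  have hprod : ∀ (ν : Measure (Fin n → ℝ)) [IsProbabilityMeasure ν] (a : Fin n → ℝ),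
      ∫ p, f (a + (p.1 + M *ᵥ p.2)) ∂(ρ.prod ν) = ∫ x, G a x ∂ν := by
    intro ν _ a
    rw [integral_prod_symm _ (hf.integrable_comp (hmeasa a))]
    refine integral_congr_ae (ae_of_all _ fun x => integral_congr_ae (ae_of_all _ fun s => ?_))
    simp only
    congr 1
    abel
  have e : ∀ a, ∫ s, f (a + s) ∂((ρ.prod (Q : Measure (Fin n → ℝ))).map
      fun p => p.1 + M *ᵥ p.2) = ∫ x, G a x ∂(Q : Measure (Fin n → ℝ)) := fun a => by
    have hc : Continuous fun s => f (a + s) := hf.continuous.comp (by fun_prop)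
    rw [integral_map hmeas.aemeasurable hc.aestronglyMeasurable]
    exact hprod _ a
  have e0 := e 0
  simp only [zero_add] at e0
  rw [e a, e0]
  refine hQ.integral_le_integral _ _ fun C h1 h2 h3 h4 => ?_
  have : IsProbabilityMeasure (ProbabilityTheory.cond volume C) :=
    cond_isProbabilityMeasure_of_finite (Measure.measure_pos_of_nonempty_interior volume h3).ne'
      h2.measure_lt_top.ne
  rw [← hprod _ a, ← hprod _ 0, integral_prod _ (hf.integrable_comp (hmeasa a)),
    integral_prod _ (hf.integrable_comp (hmeasa 0))]
  have := hρ _ (hf.integral_cond h1 h2 h3 h4 M) a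
  simpa only [zero_add, add_assoc] using this

/-! ### From even log-concave functions to symmetric convex sets -/

theorem Convex.infDist_midpoint_le {E : Type*} [NormedAddCommGroup E] [NormedSpace ℝ E] {C : Set E}
    (hC : Convex ℝ C) (hne : C.Nonempty) (x y : E) :
    2 * Metric.infDist ((2⁻¹ : ℝ) • (x + y)) C ≤ Metric.infDist x C + Metric.infDist y C := by
  refine le_of_forall_pos_le_add fun ε hε => ?_
  obtain ⟨p, hp, hpx⟩ := (Metric.infDist_lt_iff hne).1 (lt_add_of_pos_right (Metric.infDist x C)
    (half_pos hε))
  obtain ⟨q, hq, hqy⟩ := (Metric.infDist_lt_iff hne).1 (lt_add_of_pos_right (Metric.infDist y C)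
    (half_pos hε))
  have hmem : (2⁻¹ : ℝ) • (p + q) ∈ C := by
    rw [smul_add]
    exact hC hp hq (by norm_num) (by norm_num) (by norm_num)
  have h1 := Metric.infDist_le_dist_of_mem (x := (2⁻¹ : ℝ) • (x + y)) hmem
  have h2 : dist ((2⁻¹ : ℝ) • (x + y)) ((2⁻¹ : ℝ) • (p + q)) ≤ 2⁻¹ * (dist x p + dist y q) := by
    rw [dist_smul₀, Real.norm_of_nonneg (by norm_num)]
    exact mul_le_mul_of_nonneg_left (dist_add_add_le _ _ _ _) (by norm_num)
  linarith

/-- The distance to a convex set is convex, which makes these functions log-concave. For closed `C`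
they decrease to the indicator of `C` as `m` grows. -/
theorem isEvenLogConcave_exp_neg_infDist {n : ℕ} {C : Set (Fin n → ℝ)} (hC : Convex ℝ C)
    (hne : C.Nonempty) (hCs : ∀ x ∈ C, -x ∈ C) (m : ℕ) :
    IsEvenLogConcave fun x => Real.exp (-(m * Metric.infDist x C)) where
  continuous := by
    have := Metric.continuous_infDist_pt C
    fun_prop
  nonneg x := (Real.exp_pos _).le
  le_one x := Real.exp_le_one_iff.2 (neg_nonpos.2 (mul_nonneg m.cast_nonneg Metric.infDist_nonneg))
  even x := by
    have hle : ∀ x, Metric.infDist (-x) C ≤ Metric.infDist x C := fun x => by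
      refine (Metric.le_infDist hne).2 fun y hy => ?_
      rw [← dist_neg_neg]
      exact Metric.infDist_le_dist_of_mem (hCs y hy)
    have := le_antisymm (hle x) (by simpa using hle (-x))
    rw [this]
  mul_le x y := by
    rw [← Real.exp_add, ← Real.exp_nat_mul, Real.exp_le_exp]
    have h := mul_le_mul_of_nonneg_left (hC.infDist_midpoint_le hne x y) (m.cast_nonneg (α := ℝ))
    push_cast
    linarith

/-- A comparison of all integrals of even log-concave functions implies a comparison of the
probabilities of closed symmetric convex sets. -/
theorem measureReal_le_of_integral_le {n : ℕ} {ρ ν : Measure (Fin n → ℝ)} [IsProbabilityMeasure ρ]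
    [IsProbabilityMeasure ν] (h : ∀ f, IsEvenLogConcave f → ∫ x, f x ∂ρ ≤ ∫ x, f x ∂ν)
    {C : Set (Fin n → ℝ)} (hC : Convex ℝ C) (hne : C.Nonempty) (hCs : ∀ x ∈ C, -x ∈ C)
    (hcl : IsClosed C) : ρ.real C ≤ ν.real C := by
  have hf := fun m => isEvenLogConcave_exp_neg_infDist hC hne hCs m
  have hlim : Tendsto (fun m : ℕ => ∫ x, Real.exp (-(m * Metric.infDist x C)) ∂ν) atTop
      (𝓝 (∫ x, C.indicator 1 x ∂ν)) := by
    refine tendsto_integral_of_dominated_convergence (fun _ => (1 : ℝ))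
      (fun m => (hf m).continuous.aestronglyMeasurable) (integrable_const _)
      (fun m => ae_of_all _ (hf m).norm_le) (ae_of_all _ fun x => ?_)
    by_cases hx : x ∈ C
    · simp [hx, Metric.infDist_zero_of_mem hx]
    · rw [indicator_of_notMem hx]
      have hpos : 0 < Metric.infDist x C := (hcl.notMem_iff_infDist_pos hne).1 hx
      exact Real.tendsto_exp_neg_atTop_nhds_zero.comp
        (tendsto_natCast_atTop_atTop.atTop_mul_const hpos)
  rw [integral_indicator_one hcl.measurableSet] at hlim
  refine ge_of_tendsto' hlim fun m => le_trans ?_ (h _ (hf m))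
  rw [← integral_indicator_one hcl.measurableSet]
  refine integral_mono ((integrable_const (1 : ℝ)).indicator hcl.measurableSet)
    ((hf m).integrable_comp measurable_id) fun x => ?_
  by_cases hx : x ∈ C
  · simp [hx, Metric.infDist_zero_of_mem hx]
  · simpa [hx] using (Real.exp_pos _).le

/-! ### Comparison of the error with and without resets -/

/-- The law of `∑ i < j, F ^ i w_i` for independent `w_i` with law `Q`. -/
noncomputable def noiseSumLaw {n : ℕ} (F : Matrix (Fin n) (Fin n) ℝ) (Q : Measure (Fin n → ℝ)) :
    ℕ → Measure (Fin n → ℝ)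
  | 0 => Measure.dirac 0
  | j + 1 => ((noiseSumLaw F Q j).prod Q).map fun p => p.1 + F ^ j *ᵥ p.2

instance isProbabilityMeasure_noiseSumLaw {n : ℕ} (F : Matrix (Fin n) (Fin n) ℝ)
    (Q : Measure (Fin n → ℝ)) [IsProbabilityMeasure Q] :
    ∀ j, IsProbabilityMeasure (noiseSumLaw F Q j)
  | 0 => Measure.dirac.isProbabilityMeasure
  | j + 1 => by
    have := isProbabilityMeasure_noiseSumLaw F Q j
    exact Measure.isProbabilityMeasure_map (by fun_prop)

theorem isPeaked_noiseSumLaw {n : ℕ} (F : Matrix (Fin n) (Fin n) ℝ)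
    {Q : ProbabilityMeasure (Fin n → ℝ)} (hQ : IsCentralConvexUnimodal Q) :
    ∀ j, IsPeaked (noiseSumLaw F (Q : Measure (Fin n → ℝ)) j)
  | 0 => isPeaked_dirac_zero
  | j + 1 => (isPeaked_noiseSumLaw F hQ j).map_add_mulVec hQ (F ^ j)

theorem IsEvenLogConcave.integral_noiseSumLaw_succ {n : ℕ} {f : (Fin n → ℝ) → ℝ}
    (hf : IsEvenLogConcave f) (F : Matrix (Fin n) (Fin n) ℝ) (Q : Measure (Fin n → ℝ))
    [IsProbabilityMeasure Q] (j : ℕ) (y : Fin n → ℝ) :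
    ∫ s, f (y + s) ∂(noiseSumLaw F Q (j + 1)) =
      ∫ x, ∫ s, f (y + F ^ j *ᵥ x + s) ∂(noiseSumLaw F Q j) ∂Q := by
  have hc : Continuous fun s => f (y + s) := hf.continuous.comp (by fun_prop)
  rw [noiseSumLaw, integral_map (by fun_prop) hc.aestronglyMeasurable,
    integral_prod_symm _ (hf.integrable_comp (by fun_prop))]
  refine integral_congr_ae (ae_of_all _ fun x => integral_congr_ae (ae_of_all _ fun s => ?_))
  simp only
  congr 1
  abel

theorem IsEvenLogConcave.integrable_integral_add {n : ℕ} {f : (Fin n → ℝ) → ℝ}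
    (hf : IsEvenLogConcave f) {α : Type*} [MeasurableSpace α] {ν : Measure α}
    [IsFiniteMeasure ν] (ρ : Measure (Fin n → ℝ)) [IsProbabilityMeasure ρ] {u : α → Fin n → ℝ}
    (hu : Measurable u) : Integrable (fun x => ∫ s, f (u x + s) ∂ρ) ν :=
  Integrable.of_bound ((hf.continuous_integral_add measurable_id).measurable.comp
    hu).aestronglyMeasurable 1 (ae_of_all _ fun x => by
      rw [Real.norm_of_nonneg hf.integral_comp_nonneg]
      exact hf.integral_comp_le_one (by fun_prop))

section Resets

variable {n : ℕ} {Ω : Type*} [MeasurableSpace Ω] {μ : Measure Ω} [IsProbabilityMeasure μ]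
  {Q : ProbabilityMeasure (Fin n → ℝ)} {F : Matrix (Fin n) (Fin n) ℝ}
  {w e r : ℕ → Ω → Fin n → ℝ}

/-- The right side describes an error that is reset up to time `k` and then runs freely for `j` more
steps. Leaving `j` general lets the induction on `k` trade one free step for one step with a
possible reset. -/
theorem integral_noiseSumLaw_add_le (hQ : IsCentralConvexUnimodal Q)
    (hw : ∀ k, Measurable (w k)) (hlaw : ∀ k, μ.map (w k) = (Q : Measure (Fin n → ℝ)))
    (he : ∀ k, Measurable (e k)) (hr : ∀ k, Measurable (r k))
    (hind : ∀ k, IndepFun (r k) (w k) μ) (h0 : ∀ ω, e 0 ω = 0)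
    (hreset : ∀ k ω, r k ω = 0 ∨ r k ω = e k ω)
    (hstep : ∀ k ω, e (k + 1) ω = F *ᵥ r k ω + w k ω) {f : (Fin n → ℝ) → ℝ}
    (hf : IsEvenLogConcave f) : ∀ k j : ℕ,
    ∫ s, f s ∂(noiseSumLaw F (Q : Measure (Fin n → ℝ)) (k + j)) ≤
      ∫ ω, ∫ s, f (F ^ j *ᵥ e k ω + s) ∂(noiseSumLaw F (Q : Measure (Fin n → ℝ)) j) ∂μ
  | 0, j => by simp [h0]
  | k + 1, j => by
    set ρ := noiseSumLaw F (Q : Measure (Fin n → ℝ)) with hρ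
    have hcont : ∀ j, Continuous fun y => ∫ s, f (y + s) ∂(ρ j) :=
      fun j => hf.continuous_integral_add measurable_id
    have hmul : ∀ j (u : Ω → Fin n → ℝ), Measurable u → Measurable fun ω => F ^ j *ᵥ u ω :=
      fun j u hu => (by fun_prop : Measurable fun x => F ^ j *ᵥ x).comp hu
    calc ∫ s, f s ∂(ρ (k + 1 + j)) = ∫ s, f s ∂(ρ (k + (j + 1))) := by
          rw [add_right_comm, add_assoc]
      _ ≤ ∫ ω, ∫ s, f (F ^ (j + 1) *ᵥ e k ω + s) ∂(ρ (j + 1)) ∂μ :=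
          integral_noiseSumLaw_add_le hQ hw hlaw he hr hind h0 hreset hstep hf k (j + 1)
      _ ≤ ∫ ω, ∫ s, f (F ^ (j + 1) *ᵥ r k ω + s) ∂(ρ (j + 1)) ∂μ := by
          -- Pointwise in `ω`, a reset replaces the shift `F ^ (j + 1) e_k` by zero, which
          -- peakedness of the remaining noise favours. No assumption on how the reset is chosen is
          -- needed.
          refine integral_mono (hf.integrable_integral_add _ (hmul _ _ (he k))) (hf.integrable_integral_add _ (hmul _ _ (hr k)))
            fun ω => ?_
          rcases hreset k ω with h | h
          · simpa [h] using isPeaked_noiseSumLaw F hQ (j + 1) f hf _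
          · simp [h]
      _ = ∫ p, ∫ s, f (F ^ (j + 1) *ᵥ p.1 + F ^ j *ᵥ p.2 + s) ∂(ρ j)
            ∂((μ.map (r k)).prod (Q : Measure (Fin n → ℝ))) := by
          have : IsProbabilityMeasure (μ.map (r k)) :=
            Measure.isProbabilityMeasure_map (hr k).aemeasurable
          have hc : Continuous fun y => ∫ s, f (F ^ (j + 1) *ᵥ y + s) ∂(ρ (j + 1)) :=
            (hcont (j + 1)).comp (by fun_prop)
          rw [integral_prod _ (hf.integrable_integral_add _ (by fun_prop)),
            ← integral_map (hr k).aemeasurable hc.aestronglyMeasurable]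
          exact integral_congr_ae (ae_of_all _ fun ω => hf.integral_noiseSumLaw_succ F _ j _)
      _ = ∫ ω, ∫ s, f (F ^ (j + 1) *ᵥ r k ω + F ^ j *ᵥ w k ω + s) ∂(ρ j) ∂μ := by
          -- The last summand of the free noise is realized by the actual `w k`, which is
          -- independent of `r k`.
          rw [← hlaw k, ← (indepFun_iff_map_prod_eq_prod_map_map (hr k).aemeasurable
            (hw k).aemeasurable).1 (hind k), integral_map ((hr k).prodMk (hw k)).aemeasurable]
          exact ((hcont j).measurable.comp (by fun_prop : Measurable
            fun p : (Fin n → ℝ) × (Fin n → ℝ) => F ^ (j + 1) *ᵥ p.1 + F ^ j *ᵥ p.2)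
            ).aestronglyMeasurable
      _ = ∫ ω, ∫ s, f (F ^ j *ᵥ e (k + 1) ω + s) ∂(ρ j) ∂μ := by
          simp only [hstep, Matrix.mulVec_add, Matrix.mulVec_mulVec, pow_succ]

/-- An error process with arbitrary resets to zero is at least as concentrated on closed symmetric
convex sets as the process that is never reset. -/
theorem noiseSumLaw_real_le (hQ : IsCentralConvexUnimodal Q)
    (hw : ∀ k, Measurable (w k)) (hlaw : ∀ k, μ.map (w k) = (Q : Measure (Fin n → ℝ)))
    (he : ∀ k, Measurable (e k)) (hr : ∀ k, Measurable (r k))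
    (hind : ∀ k, IndepFun (r k) (w k) μ) (h0 : ∀ ω, e 0 ω = 0)
    (hreset : ∀ k ω, r k ω = 0 ∨ r k ω = e k ω)
    (hstep : ∀ k ω, e (k + 1) ω = F *ᵥ r k ω + w k ω) {C : Set (Fin n → ℝ)} (hC : Convex ℝ C)
    (hne : C.Nonempty) (hCs : ∀ x ∈ C, -x ∈ C) (hcl : IsClosed C) (k : ℕ) :
    (noiseSumLaw F (Q : Measure (Fin n → ℝ)) k).real C ≤ μ.real {ω | r k ω ∈ C} := by
  have : IsProbabilityMeasure (μ.map (r k)) :=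
    Measure.isProbabilityMeasure_map (hr k).aemeasurable
  have := measureReal_le_of_integral_le (ρ := noiseSumLaw F (Q : Measure (Fin n → ℝ)) k)
    (ν := μ.map (r k)) (fun f hf => ?_) hC hne hCs hcl
  · rwa [map_measureReal_apply (hr k) hcl.measurableSet] at this
  · rw [integral_map (hr k).aemeasurable hf.continuous.aestronglyMeasurable]
    -- With `j = 0` no free noise remains, so this bounds the integral for `e k`; the reset at time
    -- `k` itself is handled by `f ≤ f 0`.
    have h1 := integral_noiseSumLaw_add_le hQ hw hlaw he hr hind h0 hreset hstep hf k 0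
    simp only [noiseSumLaw, integral_dirac, add_zero, pow_zero, Matrix.one_mulVec] at h1
    refine h1.trans (integral_mono (hf.integrable_comp (he k)) (hf.integrable_comp (hr k))
      fun ω => ?_)
    rcases hreset k ω with h | h
    · simpa [h] using hf.le_zero _
    · simp [h]

end Resets

/-! ### Covariances and Gaussian laws -/

/-- A square-integrable distribution with mean zero and covariance matrix `E`, expressed through
its one-dimensional marginals. -/
structure IsCenteredWithCov {n : ℕ} (ρ : Measure (Fin n → ℝ)) (E : Matrix (Fin n) (Fin n) ℝ) :
    Prop where
  memLp : ∀ l : Fin n → ℝ, MemLp (fun x => l ⬝ᵥ x) 2 ρ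
  mean : ∀ l : Fin n → ℝ, ∫ x, l ⬝ᵥ x ∂ρ = 0
  sq : ∀ l : Fin n → ℝ, ∫ x, (l ⬝ᵥ x) ^ 2 ∂ρ = l ⬝ᵥ (E *ᵥ l)

theorem isCenteredWithCov_varMatrix {n : ℕ} {Q : Measure (Fin n → ℝ)} [IsProbabilityMeasure Q]
    (h2 : MemLp id 2 Q) (h0 : ∫ x, x ∂Q = 0) : IsCenteredWithCov Q (varMatrix Q) := by
  have hi : ∀ i, MemLp (fun x : Fin n → ℝ => x i) 2 Q := fun i => MemLp.eval h2 i
  have hmem : ∀ l : Fin n → ℝ, MemLp (fun x => l ⬝ᵥ x) 2 Q := fun l =>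
    memLp_finsetSum _ fun i _ => (hi i).const_mul (l i)
  have hmean : ∀ l : Fin n → ℝ, ∫ x, l ⬝ᵥ x ∂Q = 0 := fun l => by
    have hint : Integrable (fun x : Fin n → ℝ => x) Q := h2.integrable one_le_two
    have hi0 : ∀ i, ∫ x, x i ∂Q = 0 := fun i => by
      rw [← eval_integral fun i => (hi i).integrable one_le_two, h0]; rfl
    simp only [dotProduct]
    rw [integral_finsetSum _ fun i _ => ((hi i).integrable one_le_two).const_mul _]
    simp [integral_const_mul, hi0]
  refine ⟨hmem, hmean, fun l => ?_⟩
  have hvar : ∫ x, (l ⬝ᵥ x) ^ 2 ∂Q = cov[fun x => l ⬝ᵥ x, fun x => l ⬝ᵥ x; Q] := by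
    rw [covariance_eq_sub (hmem l) (hmem l), hmean l]
    simp [sq]
  rw [hvar]
  simp only [dotProduct]
  rw [covariance_fun_sum_fun_sum (fun i => (hi i).const_mul _) fun i => (hi i).const_mul _]
  simp only [covariance_const_mul_left, covariance_const_mul_right, Matrix.mulVec, dotProduct,
    varMatrix, Matrix.of_apply, Finset.mul_sum]
  refine Finset.sum_congr rfl fun i _ => Finset.sum_congr rfl fun j _ => by ring

theorem isCenteredWithCov_dirac_zero {n : ℕ} :
    IsCenteredWithCov (Measure.dirac (0 : Fin n → ℝ)) 0 where
  memLp l := (memLp_const (0 : ℝ)).ae_eq (by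
    rw [Filter.EventuallyEq, ae_dirac_eq]; simp)
  mean l := by simp
  sq l := by simp

namespace IsCenteredWithCov

variable {n : ℕ} {ρ Q : Measure (Fin n → ℝ)} {E W : Matrix (Fin n) (Fin n) ℝ}

theorem nonneg (h : IsCenteredWithCov ρ E) (l : Fin n → ℝ) : 0 ≤ l ⬝ᵥ (E *ᵥ l) := by
  rw [← h.sq]; exact integral_nonneg fun _ => sq_nonneg _

theorem map_mulVec (h : IsCenteredWithCov ρ E) (M : Matrix (Fin n) (Fin n) ℝ) :
    IsCenteredWithCov (ρ.map fun x => M *ᵥ x) (M * E * Mᵀ) := by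
  have hm : AEMeasurable (fun x => M *ᵥ x) ρ := Measurable.aemeasurable (by fun_prop)
  have hl : ∀ l : Fin n → ℝ, Continuous fun x : Fin n → ℝ => l ⬝ᵥ x := fun l => by fun_prop
  have hl2 : ∀ l : Fin n → ℝ, Continuous fun x : Fin n → ℝ => (l ⬝ᵥ x) ^ 2 := fun l => (hl l).pow 2
  have e : ∀ l x : Fin n → ℝ, l ⬝ᵥ (M *ᵥ x) = (Mᵀ *ᵥ l) ⬝ᵥ x := fun l x => by
    rw [Matrix.dotProduct_mulVec, Matrix.mulVec_transpose]
  refine ⟨fun l => ?_, fun l => ?_, fun l => ?_⟩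
  · rw [memLp_map_measure_iff (hl l).aestronglyMeasurable hm]
    simpa only [Function.comp_def, e] using h.memLp _
  · rw [integral_map hm (hl l).aestronglyMeasurable]
    simpa only [e] using h.mean _
  · rw [integral_map hm (hl2 l).aestronglyMeasurable]
    simp only [e]
    rw [h.sq, ← e, Matrix.mulVec_mulVec, Matrix.mulVec_mulVec, Matrix.mul_assoc]

theorem map_add [IsProbabilityMeasure ρ] [IsProbabilityMeasure Q] (h : IsCenteredWithCov ρ E)
    (h' : IsCenteredWithCov Q W) :
    IsCenteredWithCov ((ρ.prod Q).map fun p => p.1 + p.2) (E + W) := by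
  have hm : AEMeasurable (fun p : (Fin n → ℝ) × (Fin n → ℝ) => p.1 + p.2) (ρ.prod Q) :=
    Measurable.aemeasurable (by fun_prop)
  have hl : ∀ l : Fin n → ℝ, Continuous fun x : Fin n → ℝ => l ⬝ᵥ x := fun l => by fun_prop
  have hl2 : ∀ l : Fin n → ℝ, Continuous fun x : Fin n → ℝ => (l ⬝ᵥ x) ^ 2 := fun l => (hl l).pow 2
  have h1 : ∀ l : Fin n → ℝ, MemLp (fun p : (Fin n → ℝ) × (Fin n → ℝ) => l ⬝ᵥ p.1) 2
      (ρ.prod Q) := fun l => (h.memLp l).comp_fst Q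
  have h2 : ∀ l : Fin n → ℝ, MemLp (fun p : (Fin n → ℝ) × (Fin n → ℝ) => l ⬝ᵥ p.2) 2
      (ρ.prod Q) := fun l => (h'.memLp l).comp_snd ρ
  refine ⟨fun l => ?_, fun l => ?_, fun l => ?_⟩
  · rw [memLp_map_measure_iff (hl l).aestronglyMeasurable hm]
    simp only [Function.comp_def, dotProduct_add]
    exact (h1 l).add (h2 l)
  · rw [integral_map hm (hl l).aestronglyMeasurable]
    simp only [dotProduct_add]
    rw [integral_add ((h1 l).integrable one_le_two) ((h2 l).integrable one_le_two),
      integral_fun_fst (fun x => l ⬝ᵥ x), integral_fun_snd (fun x => l ⬝ᵥ x), h.mean, h'.mean]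
    simp
  · rw [integral_map hm (hl2 l).aestronglyMeasurable]
    have e : ∀ p : (Fin n → ℝ) × (Fin n → ℝ), (l ⬝ᵥ (p.1 + p.2)) ^ 2 =
        (l ⬝ᵥ p.1) ^ 2 + 2 * ((l ⬝ᵥ p.1) * (l ⬝ᵥ p.2)) + (l ⬝ᵥ p.2) ^ 2 := fun p => by
      rw [dotProduct_add]; ring
    have i1 := (h1 l).integrable_sq
    have i2 := (h2 l).integrable_sq
    have i3 : Integrable (fun p : (Fin n → ℝ) × (Fin n → ℝ) => 2 * ((l ⬝ᵥ p.1) * (l ⬝ᵥ p.2)))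
      (ρ.prod Q) := ((h1 l).integrable_mul (h2 l)).const_mul 2
    have i13 : Integrable (fun p : (Fin n → ℝ) × (Fin n → ℝ) =>
      (l ⬝ᵥ p.1) ^ 2 + 2 * ((l ⬝ᵥ p.1) * (l ⬝ᵥ p.2))) (ρ.prod Q) := i1.add i3
    simp only [e]
    rw [integral_add i13 i2, integral_add i1 i3, integral_const_mul,
      integral_prod_mul (fun x => l ⬝ᵥ x) (fun x => l ⬝ᵥ x),
      integral_fun_fst (fun x => (l ⬝ᵥ x) ^ 2), integral_fun_snd (fun x => (l ⬝ᵥ x) ^ 2), h.mean,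
      h.sq, h'.sq]
    simp [Matrix.add_mulVec, dotProduct_add]

end IsCenteredWithCov

/-- The covariance matrix of `∑ i < j, F ^ i w_i` for independent `w_i` with covariance `W`. -/
def noiseSumCov {n : ℕ} (F W : Matrix (Fin n) (Fin n) ℝ) : ℕ → Matrix (Fin n) (Fin n) ℝ
  | 0 => 0
  | j + 1 => noiseSumCov F W j + F ^ j * W * (F ^ j)ᵀ

/-- Splits the step into a linear image and an independent sum, the two operations under which
covariances and Gaussianity are tracked. -/
theorem noiseSumLaw_succ {n : ℕ} (F : Matrix (Fin n) (Fin n) ℝ) (Q : Measure (Fin n → ℝ))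
    [IsProbabilityMeasure Q] (j : ℕ) :
    noiseSumLaw F Q (j + 1) =
      ((noiseSumLaw F Q j).prod (Q.map fun x => F ^ j *ᵥ x)).map fun p => p.1 + p.2 := by
  have h := Measure.map_prod_map (noiseSumLaw F Q j) Q (f := id) (g := fun x => F ^ j *ᵥ x)
    measurable_id (by fun_prop)
  rw [Measure.map_id] at h
  rw [h, Measure.map_map (by fun_prop) (by fun_prop)]
  rfl

theorem isCenteredWithCov_noiseSumLaw {n : ℕ} (F : Matrix (Fin n) (Fin n) ℝ)
    {Q : Measure (Fin n → ℝ)} [IsProbabilityMeasure Q] {W : Matrix (Fin n) (Fin n) ℝ}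
    (h : IsCenteredWithCov Q W) : ∀ j, IsCenteredWithCov (noiseSumLaw F Q j) (noiseSumCov F W j)
  | 0 => isCenteredWithCov_dirac_zero
  | j + 1 => by
    have : IsProbabilityMeasure (Q.map fun x => F ^ j *ᵥ x) :=
      Measure.isProbabilityMeasure_map (by fun_prop)
    rw [noiseSumLaw_succ]
    exact (isCenteredWithCov_noiseSumLaw F h j).map_add (h.map_mulVec _)

instance isGaussian_noiseSumLaw {n : ℕ} (F : Matrix (Fin n) (Fin n) ℝ)
    (Q : Measure (Fin n → ℝ)) [IsGaussian Q] : ∀ j, IsGaussian (noiseSumLaw F Q j)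
  | 0 => by rw [noiseSumLaw]; infer_instance
  | j + 1 => by
    have := isGaussian_noiseSumLaw F Q j
    have : IsGaussian (Q.map fun x => F ^ j *ᵥ x) :=
      isGaussian_map (LinearMap.toContinuousLinearMap (Matrix.mulVecLin (F ^ j)))
    rw [noiseSumLaw_succ]
    exact isGaussian_map (ContinuousLinearMap.fst ℝ (Fin n → ℝ) (Fin n → ℝ) +
      ContinuousLinearMap.snd ℝ (Fin n → ℝ) (Fin n → ℝ))

/-- A centred Gaussian measure is determined by its covariance matrix. -/
theorem IsCenteredWithCov.eq_of_isGaussian {n : ℕ} {ρ ν : Measure (Fin n → ℝ)} [IsGaussian ρ]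
    [IsGaussian ν] {E : Matrix (Fin n) (Fin n) ℝ} (hρ : IsCenteredWithCov ρ E)
    (hν : IsCenteredWithCov ν E) : ρ = ν := by
  refine Measure.ext_of_charFunDual (funext fun L => ?_)
  -- Every functional is a dot product, so its mean and variance, and hence the Gaussian
  -- characteristic function, are fixed by `E`.
  have hL : ∀ x, L x = (fun i => L (Pi.single i 1)) ⬝ᵥ x := fun x => by
    conv_lhs => rw [pi_eq_sum_univ' x]
    simp [dotProduct, mul_comm]
  have hfun : (L : (Fin n → ℝ) → ℝ) = fun x => (fun i => L (Pi.single i 1)) ⬝ᵥ x := funext hL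
  have hvar : ∀ (κ : Measure (Fin n → ℝ)) [IsGaussian κ], IsCenteredWithCov κ E →
      κ[L] = 0 ∧ Var[L; κ] =
        (fun i => L (Pi.single i 1)) ⬝ᵥ (E *ᵥ fun i => L (Pi.single i 1)) := fun κ _ h => by
    rw [hfun]
    refine ⟨h.mean _, ?_⟩
    rw [variance_eq_integral (h.memLp _).aemeasurable, h.mean, ← h.sq]
    simp
  rw [IsGaussian.charFunDual_eq, IsGaussian.charFunDual_eq, (hvar ρ hρ).2, (hvar ν hν).2,
    integral_complex_ofReal, integral_complex_ofReal, (hvar ρ hρ).1, (hvar ν hν).1]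

theorem isCenteredWithCov_pi_gaussianReal (n : ℕ) :
    IsCenteredWithCov (Measure.pi fun _ : Fin n => gaussianReal 0 1) 1 := by
  have hi : ∀ i, MemLp (fun x : Fin n → ℝ => x i) 2 (Measure.pi fun _ : Fin n => gaussianReal 0 1) :=
    fun i => (IsGaussian.memLp_two_id (μ := gaussianReal 0 1)).comp_measurePreserving
      (measurePreserving_eval _ i)
  have hmem : ∀ l : Fin n → ℝ, MemLp (fun x => l ⬝ᵥ x) 2
      (Measure.pi fun _ : Fin n => gaussianReal 0 1) := fun l =>
    memLp_finsetSum _ fun i _ => (hi i).const_mul (l i)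
  have hmean : ∀ l : Fin n → ℝ, ∫ x, l ⬝ᵥ x ∂(Measure.pi fun _ : Fin n => gaussianReal 0 1) = 0 :=
    fun l => by
      simp only [dotProduct]
      rw [integral_finsetSum _ fun i _ => ((hi i).integrable one_le_two).const_mul _]
      simp [integral_const_mul, integral_eval]
  refine ⟨hmem, hmean, fun l => ?_⟩
  have hvar := variance_sum_pi (μ := fun _ : Fin n => gaussianReal 0 1)
    (X := fun i x => l i * x) fun i => (IsGaussian.memLp_two_id (μ := gaussianReal 0 1)).const_mul _
  have hfun : (∑ i, fun ω : Fin n → ℝ => l i * ω i) = fun x => l ⬝ᵥ x := by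
    ext x; simp [dotProduct]
  rw [hfun, variance_eq_integral (hmem l).aemeasurable, hmean] at hvar
  simp only [sub_zero] at hvar
  rw [hvar, Matrix.one_mulVec]
  refine Finset.sum_congr rfl fun i _ => ?_
  change Var[fun x => l i * id x; gaussianReal 0 1] = _
  rw [variance_const_mul, variance_id_gaussianReal]
  simp [sq]

instance isGaussian_pi_gaussianReal (n : ℕ) :
    IsGaussian (Measure.pi fun _ : Fin n => gaussianReal 0 1) := by
  have h := map_pi_eq_stdGaussian (ι := Fin n)
  have : Measure.pi (fun _ : Fin n => gaussianReal 0 1) =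
      (stdGaussian (EuclideanSpace ℝ (Fin n))).map (EuclideanSpace.equiv (Fin n) ℝ) := by
    rw [← h, Measure.map_map (by fun_prop) (by fun_prop)]
    exact Measure.map_id.symm
  rw [this]
  infer_instance

/-! ### Ellipsoids and their probabilities -/

open scoped MatrixOrder in
theorem Matrix.PosSemidef.exists_eq_transpose_mul_self {n : ℕ} {E : Matrix (Fin n) (Fin n) ℝ}
    (hE : E.PosSemidef) : ∃ L : Matrix (Fin n) (Fin n) ℝ, E = Lᵀ * L := by
  obtain ⟨L, hL⟩ := CStarAlgebra.nonneg_iff_eq_star_mul_self.1 hE.nonneg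
  exact ⟨L, by rw [hL, Matrix.star_eq_conjTranspose, Matrix.conjTranspose_eq_transpose_of_trivial]⟩

theorem isClosed_ellipsoid {n : ℕ} (E : Matrix (Fin n) (Fin n) ℝ) :
    IsClosed (ellipsoid E) := by
  simp only [ellipsoid, ofPred_forall]
  exact isClosed_iInter fun l => isClosed_le (by fun_prop) continuous_const

/-- The multivariate Chebyshev inequality. -/
theorem IsCenteredWithCov.le_measureReal_ellipsoid {n : ℕ} {ρ : Measure (Fin n → ℝ)}
    [IsProbabilityMeasure ρ] {E : Matrix (Fin n) (Fin n) ℝ} (h : IsCenteredWithCov ρ E)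
    (hE : E.PosDef) {c : ℝ} (hc : 0 < c) : 1 - n / c ≤ ρ.real (ellipsoid (c • E)) := by
  have hinv : (c • E)⁻¹.PosDef := (hE.smul hc).inv
  obtain ⟨L, hL⟩ := hinv.posSemidef.exists_eq_transpose_mul_self
  have hq : ∀ x, x ⬝ᵥ ((c • E)⁻¹ *ᵥ x) = ∑ i, (L i ⬝ᵥ x) ^ 2 := fun x => by
    rw [hL, ← Matrix.mulVec_mulVec, Matrix.dotProduct_mulVec, ← Matrix.mulVec_transpose,
      Matrix.transpose_transpose]
    simp only [dotProduct, Matrix.mulVec, ← pow_two]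
  have hint : ∀ i, Integrable (fun x => (L i ⬝ᵥ x) ^ 2) ρ := fun i => (h.memLp (L i)).integrable_sq
  -- The expected quadratic form is `tr (L E Lᵀ) = tr ((cE)⁻¹ E) = n / c`; Markov's inequality at
  -- level one then gives the bound.
  have htr : ∫ x, x ⬝ᵥ ((c • E)⁻¹ *ᵥ x) ∂ρ = n / c := by
    simp only [hq]
    rw [integral_finsetSum _ fun i _ => hint i]
    simp only [h.sq]
    have e1 : ∑ i, L i ⬝ᵥ (E *ᵥ L i) = (L * E * Lᵀ).trace := by
      simp only [Matrix.trace, Matrix.diag, Matrix.mul_apply, dotProduct, Matrix.mulVec,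
        Matrix.transpose_apply, Finset.mul_sum, Finset.sum_mul]
      refine Finset.sum_congr rfl fun i _ => ?_
      rw [Finset.sum_comm]
      exact Finset.sum_congr rfl fun j _ => Finset.sum_congr rfl fun k _ => by ring
    have hu : IsUnit (c • E).det := (hE.smul hc).det_pos.ne'.isUnit
    have e2 : (c • E)⁻¹ * E = c⁻¹ • (1 : Matrix (Fin n) (Fin n) ℝ) := by
      rw [← Matrix.nonsing_inv_mul _ hu, Matrix.mul_smul, smul_smul, inv_mul_cancel₀ hc.ne',
        one_smul]
    rw [e1, Matrix.trace_mul_comm, ← Matrix.mul_assoc, ← hL, e2]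
    simp [Matrix.trace_smul, div_eq_inv_mul]
  have hmark := mul_meas_ge_le_integral_of_nonneg (μ := ρ)
    (f := fun x => x ⬝ᵥ ((c • E)⁻¹ *ᵥ x)) (ae_of_all _ fun x => by
      simp only [hq]; exact Finset.sum_nonneg fun i _ => sq_nonneg _)
    (by simp only [hq]; exact integrable_finsetSum _ fun i _ => hint i) 1
  rw [htr, one_mul] at hmark
  have hcompl : (ellipsoid (c • E))ᶜ ⊆ {x | 1 ≤ x ⬝ᵥ ((c • E)⁻¹ *ᵥ x)} := fun x hx => by
    rw [ellipsoid_eq_of_posDef (hE.smul hc)] at hx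
    simp only [mem_compl_iff, mem_ofPred_eq, not_le] at hx ⊢
    exact hx.le
  have h2 := (measureReal_mono hcompl).trans hmark
  rw [probReal_compl_eq_one_sub (isClosed_ellipsoid _).measurableSet] at h2
  linarith

/-- Writing `E = Lᵀ L`, the measure is the law of `Lᵀ g` with `g` standard normal. Cauchy–Schwarz
puts `Lᵀ g` in the ellipsoid as soon as `|g|² ≤ c`, even for singular `E`. -/
theorem IsCenteredWithCov.chiSquaredCDF_le_measureReal_ellipsoid {n : ℕ} {ρ : Measure (Fin n → ℝ)}
    [IsGaussian ρ] {E : Matrix (Fin n) (Fin n) ℝ} (h : IsCenteredWithCov ρ E)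
    (hE : E.PosSemidef) (c : ℝ) : chiSquaredCDF n c ≤ ρ.real (ellipsoid (c • E)) := by
  obtain ⟨L, hL⟩ := hE.exists_eq_transpose_mul_self
  have : IsGaussian ((Measure.pi fun _ : Fin n => gaussianReal 0 1).map fun x => Lᵀ *ᵥ x) :=
    isGaussian_map (LinearMap.toContinuousLinearMap (Matrix.mulVecLin Lᵀ))
  have hmap := (isCenteredWithCov_pi_gaussianReal n).map_mulVec Lᵀ
  rw [Matrix.mul_one, Matrix.transpose_transpose, ← hL] at hmap
  rw [h.eq_of_isGaussian hmap, map_measureReal_apply (by fun_prop)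
    (isClosed_ellipsoid _).measurableSet]
  refine measureReal_mono fun g hg l => ?_
  simp only [mem_ofPred_eq] at hg
  have e1 : l ⬝ᵥ (Lᵀ *ᵥ g) = ∑ i, (L *ᵥ l) i * g i := by
    rw [Matrix.dotProduct_mulVec, ← Matrix.mulVec_transpose, Matrix.transpose_transpose]; rfl
  have e2 : l ⬝ᵥ ((c • E) *ᵥ l) = (∑ i, (L *ᵥ l) i ^ 2) * c := by
    rw [hL, Matrix.smul_mulVec, dotProduct_smul, ← Matrix.mulVec_mulVec, Matrix.dotProduct_mulVec,
      ← Matrix.mulVec_transpose, Matrix.transpose_transpose]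
    simp only [dotProduct, smul_eq_mul, ← pow_two, mul_comm c]
  rw [e1, e2]
  exact (Finset.sum_mul_sq_le_sq_mul_sq _ _ _).trans
    (mul_le_mul_of_nonneg_left hg (Finset.sum_nonneg fun i _ => sq_nonneg _))

/-- The infimum defining the quantile reaches level `p` by right continuity of the distribution
function; `p < 1` makes the set of candidates nonempty. -/
theorem le_chiSquaredCDF_chiSquaredQuantile (n : ℕ) {p : ℝ} (hp : p < 1) :
    p ≤ chiSquaredCDF n (chiSquaredQuantile n p) := by
  set ν := (Measure.pi fun _ : Fin n => gaussianReal 0 1).map fun g => ∑ i, g i ^ 2 with hν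
  have hm : Measurable fun g : Fin n → ℝ => ∑ i, g i ^ 2 := by fun_prop
  have : IsProbabilityMeasure ν := Measure.isProbabilityMeasure_map hm.aemeasurable
  have hcdf : ∀ c, chiSquaredCDF n c = cdf ν c := fun c => by
    rw [cdf_eq_real, hν, map_measureReal_apply hm measurableSet_Iic]; rfl
  set S := {c : ℝ | 0 ≤ c ∧ p ≤ chiSquaredCDF n c} with hS
  have hne : S.Nonempty := by
    have h1 : ∀ᶠ c in atTop, p < cdf ν c := (tendsto_cdf_atTop ν).eventually (lt_mem_nhds hp)
    obtain ⟨c, hc, hc0⟩ := (h1.and (eventually_ge_atTop 0)).exists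
    exact ⟨c, hc0, by rw [hcdf]; exact hc.le⟩
  rw [hcdf]
  refine ge_of_tendsto ((cdf ν).right_continuous (chiSquaredQuantile n p) |>.mono_left
    (nhdsWithin_mono _ Ioi_subset_Ici_self)) ?_
  filter_upwards [self_mem_nhdsWithin] with c hc
  obtain ⟨d, hd, hdc⟩ := exists_lt_of_csInf_lt hne hc
  exact hd.2.trans (by rw [hcdf]; exact monotone_cdf ν hdc.le)

theorem chiSquaredQuantile_nonneg (n : ℕ) (p : ℝ) : 0 ≤ chiSquaredQuantile n p :=
  Real.sInf_nonneg fun _ h => h.1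

theorem ellipsoid_mono {d : ℕ} {E F : Matrix (Fin d) (Fin d) ℝ}
    (h : ∀ l, l ⬝ᵥ (E *ᵥ l) ≤ l ⬝ᵥ (F *ᵥ l)) : ellipsoid E ⊆ ellipsoid F :=
  fun _ hx l => (hx l).trans (h l)

theorem convex_ellipsoid {d : ℕ} (E : Matrix (Fin d) (Fin d) ℝ) : Convex ℝ (ellipsoid E) := by
  simp only [ellipsoid, ofPred_forall]
  refine convex_iInter fun l => ?_
  intro x hx y hy s t hs ht hst
  simp only [mem_ofPred_eq, dotProduct_add, dotProduct_smul, smul_eq_mul] at hx hy ⊢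
  obtain rfl : t = 1 - s := by linarith
  nlinarith [mul_nonneg (mul_nonneg hs ht) (sq_nonneg (l ⬝ᵥ x - l ⬝ᵥ y))]

theorem neg_mem_ellipsoid {d : ℕ} {E : Matrix (Fin d) (Fin d) ℝ} :
    ∀ x ∈ ellipsoid E, -x ∈ ellipsoid E := fun x hx l => by
  rw [dotProduct_neg, neg_sq]; exact hx l

theorem zero_mem_ellipsoid {d : ℕ} {E : Matrix (Fin d) (Fin d) ℝ}
    (hE : ∀ l, 0 ≤ l ⬝ᵥ (E *ᵥ l)) : (0 : Fin d → ℝ) ∈ ellipsoid E := fun l => by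
  simpa using hE l

/-- The support-function description makes this immediate: test `x` against `Kᵀ l`. It covers a
degenerate image shape `K E Kᵀ`. -/
theorem mulVec_mem_ellipsoid {n m : ℕ} {E : Matrix (Fin n) (Fin n) ℝ}
    (K : Matrix (Fin m) (Fin n) ℝ) {c : ℝ} {x : Fin n → ℝ} (hx : x ∈ ellipsoid (c • E)) :
    K *ᵥ x ∈ ellipsoid (c • (K * E * Kᵀ)) := fun l => by
  have h := hx (Kᵀ *ᵥ l)
  have e : ∀ y : Fin n → ℝ, l ⬝ᵥ (K *ᵥ y) = (Kᵀ *ᵥ l) ⬝ᵥ y := fun y => by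
    rw [Matrix.dotProduct_mulVec, Matrix.mulVec_transpose]
  rw [Matrix.smul_mulVec, dotProduct_smul] at h ⊢
  rwa [← Matrix.mulVec_mulVec, ← Matrix.mulVec_mulVec, e, e]

/-! ### Schur stability and the Lyapunov equation -/

/-- Gelfand's formula gives `‖G ^ k‖ ≤ r ^ k` eventually, for some `r < 1`. -/
theorem tendsto_pow_zero_of_spectralRadius_lt_one {A : Type*} [NormedRing A] [NormedAlgebra ℂ A]
    [CompleteSpace A] {G : A} (h : spectralRadius ℂ G < 1) :
    Tendsto (fun k : ℕ => G ^ k) atTop (𝓝 0) := by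
  obtain ⟨r, hr, hr1⟩ := exists_between h
  have hev := (spectrum.pow_nnnorm_pow_one_div_tendsto_nhds_spectralRadius G).eventually
    (gt_mem_nhds hr)
  have hbound : ∀ᶠ k : ℕ in atTop, (‖G ^ k‖₊ : ℝ≥0∞) ≤ r ^ k := by
    filter_upwards [hev, eventually_gt_atTop 0] with k hk hk0
    have h1 := ENNReal.rpow_le_rpow hk.le (Nat.cast_nonneg' (α := ℝ) k)
    rwa [← ENNReal.rpow_mul, one_div, inv_mul_cancel₀ (by positivity), ENNReal.rpow_one,
      ENNReal.rpow_natCast] at h1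
  rw [tendsto_zero_iff_enorm_tendsto_zero]
  exact tendsto_of_tendsto_of_tendsto_of_le_of_le' tendsto_const_nhds
    (ENNReal.tendsto_pow_atTop_nhds_zero_of_lt_one hr1) (by simp) hbound

attribute [local instance] Matrix.linftyOpNormedAddCommGroup Matrix.linftyOpNormedRing
  Matrix.linftyOpNormedAlgebra in
/-- The powers of a Schur stable matrix tend to zero. -/
theorem IsSchurStable.tendsto_pow {n : ℕ} {F : Matrix (Fin n) (Fin n) ℝ} (hF : IsSchurStable F) :
    Tendsto (fun k : ℕ => F ^ k) atTop (𝓝 0) := by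
  rcases Nat.eq_zero_or_pos n with rfl | hn
  · simp only [Subsingleton.elim _ (0 : Matrix (Fin 0) (Fin 0) ℝ)]
    exact tendsto_const_nhds
  have : NeZero n := ⟨hn.ne'⟩
  set G := F.map (algebraMap ℝ ℂ) with hG
  have hrad : spectralRadius ℂ G < 1 :=
    spectrum.spectralRadius_lt_of_forall_lt G (r := 1) fun z hz => by
      exact_mod_cast hF z hz
  have hGlim : Tendsto (fun k : ℕ => G ^ k) atTop (𝓝 0) :=
    tendsto_pow_zero_of_spectralRadius_lt_one hrad
  refine tendsto_pi_nhds.2 fun i => tendsto_pi_nhds.2 fun j => ?_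
  have hi := tendsto_pi_nhds.1 (tendsto_pi_nhds.1 hGlim i)
  have hij := (Complex.continuous_re.tendsto _).comp (hi j)
  refine hij.congr fun k => ?_
  have : G ^ k = (F ^ k).map (algebraMap ℝ ℂ) := (map_pow (algebraMap ℝ ℂ).mapMatrix F k).symm
  simp [this]

theorem eq_noiseSumCov_add {n : ℕ} {F E W : Matrix (Fin n) (Fin n) ℝ}
    (h : F * E * Fᵀ - E + W = 0) : ∀ k, E = noiseSumCov F W k + F ^ k * E * (F ^ k)ᵀ
  | 0 => by simp [noiseSumCov]
  | k + 1 => by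
    have h1 : E = F * E * Fᵀ + W := by
      rw [← sub_eq_zero, ← neg_eq_zero, ← h]; abel
    have h2 := eq_noiseSumCov_add h k
    have h3 : F ^ k * E * (F ^ k)ᵀ =
        F ^ k * W * (F ^ k)ᵀ + F ^ (k + 1) * E * (F ^ (k + 1))ᵀ := by
      conv_lhs => rw [h1]
      rw [pow_succ, Matrix.transpose_mul]
      noncomm_ring
    rw [noiseSumCov, add_assoc, ← h3]
    exact h2

/-- The solution of the Lyapunov equation dominates the covariance matrices of the partial sums. -/
theorem noiseSumCov_le_of_lyapunov {n : ℕ} {F E W : Matrix (Fin n) (Fin n) ℝ}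
    (hF : IsSchurStable F) (hnn : ∀ k l, 0 ≤ l ⬝ᵥ (noiseSumCov F W k *ᵥ l))
    (h : F * E * Fᵀ - E + W = 0) (k : ℕ) (l : Fin n → ℝ) :
    l ⬝ᵥ (noiseSumCov F W k *ᵥ l) ≤ l ⬝ᵥ (E *ᵥ l) := by
  have e : ∀ k l, l ⬝ᵥ (E *ᵥ l) = l ⬝ᵥ (noiseSumCov F W k *ᵥ l) +
      ((F ^ k)ᵀ *ᵥ l) ⬝ᵥ (E *ᵥ ((F ^ k)ᵀ *ᵥ l)) := fun k l => by
    conv_lhs => rw [eq_noiseSumCov_add h k]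
    rw [Matrix.add_mulVec, dotProduct_add, ← Matrix.mulVec_mulVec, ← Matrix.mulVec_mulVec,
      Matrix.dotProduct_mulVec l (F ^ k), Matrix.mulVec_transpose (F ^ k)]
  -- Positivity of `E` is derived: by `e`, `l ⬝ᵥ E l` is at least a remainder that tends to zero
  -- because `F ^ k → 0`.
  have hE : ∀ l, 0 ≤ l ⬝ᵥ (E *ᵥ l) := fun l => by
    have hc : Continuous fun M : Matrix (Fin n) (Fin n) ℝ => (Mᵀ *ᵥ l) ⬝ᵥ (E *ᵥ (Mᵀ *ᵥ l)) := by
      fun_prop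
    have hlim := (hc.tendsto 0).comp hF.tendsto_pow
    simp only [Matrix.transpose_zero, Matrix.zero_mulVec, zero_dotProduct] at hlim
    refine le_of_tendsto' hlim fun k => ?_
    have := e k l
    have := hnn k l
    simp only [Function.comp]
    linarith
  rw [e k l]
  exact le_add_of_nonneg_right (hE _)

theorem transpose_noiseSumCov {n : ℕ} {F W : Matrix (Fin n) (Fin n) ℝ} (hW : Wᵀ = W) :
    ∀ k, (noiseSumCov F W k)ᵀ = noiseSumCov F W k
  | 0 => by simp [noiseSumCov]
  | k + 1 => by
    simp [noiseSumCov, transpose_noiseSumCov hW k, Matrix.transpose_mul, hW, Matrix.mul_assoc]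

/-- Makes the covariance positive definite after one step, as needed to invert it in Chebyshev's
inequality. -/
theorem le_noiseSumCov_succ {n : ℕ} {F W : Matrix (Fin n) (Fin n) ℝ} (hW : W.PosSemidef)
    (l : Fin n → ℝ) : ∀ k, l ⬝ᵥ (W *ᵥ l) ≤ l ⬝ᵥ (noiseSumCov F W (k + 1) *ᵥ l)
  | 0 => by simp [noiseSumCov]
  | k + 1 => by
    rw [noiseSumCov, Matrix.add_mulVec, dotProduct_add]
    refine (le_noiseSumCov_succ hW l k).trans (le_add_of_nonneg_right ?_)
    have h := hW.dotProduct_mulVec_nonneg ((F ^ (k + 1))ᵀ *ᵥ l)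
    rwa [star_trivial, Matrix.mulVec_transpose, ← Matrix.dotProduct_mulVec,
      ← Matrix.mulVec_transpose, Matrix.mulVec_mulVec, Matrix.mulVec_mulVec] at h

/-- The reachable sets have at least their nominal probability under the error without resets. -/
theorem le_noiseSumLaw_real_ellipsoid {n : ℕ} {F E : Matrix (Fin n) (Fin n) ℝ}
    {Q : Measure (Fin n → ℝ)} [IsProbabilityMeasure Q] (h2 : MemLp id 2 Q) (h0 : ∫ x, x ∂Q = 0)
    (hvar : (varMatrix Q).PosDef) (hF : IsSchurStable F)
    (hE : F * E * Fᵀ - E + varMatrix Q = 0) {rad : ℝ → ℝ}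
    (hrad : rad = chebyshevRadius n ∨ (IsGaussian Q ∧ rad = chiSquaredQuantile n)) {p : ℝ}
    (hp : p < 1) (k : ℕ) :
    p ≤ (noiseSumLaw F Q k).real (ellipsoid (rad p • E)) ∧
      (0 : Fin n → ℝ) ∈ ellipsoid (rad p • E) := by
  have hcov := isCenteredWithCov_noiseSumLaw F (isCenteredWithCov_varMatrix h2 h0)
  have hW : (varMatrix Q)ᵀ = varMatrix Q := by
    simpa [Matrix.IsHermitian] using hvar.isHermitian
  have hherm : ∀ k, (noiseSumCov F (varMatrix Q) k).IsHermitian := fun k => by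
    rw [Matrix.IsHermitian, Matrix.conjTranspose_eq_transpose_of_trivial]
    exact transpose_noiseSumCov hW k
  have hle := noiseSumCov_le_of_lyapunov hF (fun k => (hcov k).nonneg) hE
  have hrad0 : 0 ≤ rad p := by
    rcases hrad with rfl | ⟨-, rfl⟩
    · exact div_nonneg n.cast_nonneg (by linarith)
    · exact chiSquaredQuantile_nonneg n p
  have hsub : ∀ k, ellipsoid (rad p • noiseSumCov F (varMatrix Q) k) ⊆ ellipsoid (rad p • E) :=
    fun k => ellipsoid_mono fun l => by
      simp only [Matrix.smul_mulVec, dotProduct_smul, smul_eq_mul]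
      exact mul_le_mul_of_nonneg_left (hle k l) hrad0
  have hzero : (0 : Fin n → ℝ) ∈ ellipsoid (rad p • E) :=
    hsub 0 (zero_mem_ellipsoid fun l => by simp [noiseSumCov])
  refine ⟨?_, hzero⟩
  rcases hrad with rfl | ⟨hG, rfl⟩
  -- Chebyshev needs a positive radius and an invertible covariance. Dimension zero, where the
  -- radius vanishes, and time zero, where the error is exactly zero, are treated apart.
  · rcases Nat.eq_zero_or_pos n with rfl | hn
    · have huniv : ellipsoid (chebyshevRadius 0 p • E) = univ :=
        eq_univ_of_forall fun x => by rwa [Subsingleton.elim x 0]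
      rw [huniv, probReal_univ]
      exact hp.le
    rcases k with - | k
    · rw [noiseSumLaw, measureReal_def, Measure.dirac_apply_of_mem hzero]
      simpa using hp.le
    · have hpos : (noiseSumCov F (varMatrix Q) (k + 1)).PosDef :=
        Matrix.PosDef.of_dotProduct_mulVec_pos (hherm _) fun x hx =>
          (hvar.dotProduct_mulVec_pos hx).trans_le (le_noiseSumCov_succ hvar.posSemidef x k)
      have hn' : (0 : ℝ) < n := by exact_mod_cast hn
      have hp' : 0 < 1 - p := by linarith
      have hc : 0 < chebyshevRadius n p := div_pos hn' hp'
      refine le_trans (le_of_eq ?_) (((hcov (k + 1)).le_measureReal_ellipsoid hpos hc).trans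
        (measureReal_mono (hsub _)))
      rw [chebyshevRadius]
      field_simp
      ring
  · have hpsd : (noiseSumCov F (varMatrix Q) k).PosSemidef :=
      Matrix.PosSemidef.of_dotProduct_mulVec_nonneg (hherm k) fun x => (hcov k).nonneg x
    exact (le_chiSquaredCDF_chiSquaredQuantile n hp).trans
      (((hcov k).chiSquaredCDF_le_measureReal_ellipsoid hpsd _).trans (measureReal_mono (hsub _)))

/-! ### Recursive feasibility and the closed-loop error -/

namespace StochMPC

variable {n m N : ℕ} (M : StochMPC n m)

theorem nominal_zero (z0 : Fin n → ℝ) (v : Fin N → Fin m → ℝ) : M.nominal z0 v 0 = z0 := rfl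

theorem nominal_succ (z0 : Fin n → ℝ) (v : Fin N → Fin m → ℝ) (i : Fin N) :
    M.nominal z0 v i.succ = M.A *ᵥ M.nominal z0 v i.castSucc + M.B *ᵥ v i := rfl

theorem initNominal_one (x z : Fin n → ℝ) : initNominal x z 1 = z := by simp [initNominal]

theorem initNominal_zero (x z : Fin n → ℝ) : initNominal x z 0 = x := by simp [initNominal]

/-- Nominal states of the shifted input sequence. -/
theorem nominal_shift (z0 : Fin n → ℝ) (v : Fin (N + 1) → Fin m → ℝ) (u : Fin m → ℝ)
    (i : Fin (N + 1)) :
    M.nominal (M.A *ᵥ z0 + M.B *ᵥ v 0) (Fin.snoc (α := fun _ => Fin m → ℝ) (Fin.tail v) u :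
      Fin (N + 1) → Fin m → ℝ) i.castSucc = M.nominal z0 v i.succ := by
  induction i using Fin.induction with
  | zero => rfl
  | succ i ih =>
    rw [← Fin.succ_castSucc, nominal_succ, ih, Fin.snoc_castSucc, nominal_succ _ _ _ i.succ]
    rfl

/-- Recursive feasibility of the performance step. -/
theorem PerfFeasible.succ [NeZero N] (hZF_inv : ∀ z ∈ M.ZF, M.AK *ᵥ z ∈ M.ZF)
    (hZF_X : M.ZF ⊆ M.tightX 0) (hZF_U : ∀ z ∈ M.ZF, M.K *ᵥ z ∈ M.tightU 0) {a b : ℕ → ℝ}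
    (ha : ∀ i, N ≤ i → a i = 0) (hb : ∀ i, N ≤ i → b i = 0) {k : ℕ} {x z : Fin n → ℝ}
    {d : (Fin N → Fin m → ℝ) × ℝ} (hd : M.PerfFeasible a b k x z d) (x' : Fin n → ℝ) :
    ∃ d' : (Fin N → Fin m → ℝ) × ℝ, M.PerfFeasible a b (k + 1) x'
      (M.A *ᵥ initNominal x z d.2 + M.B *ᵥ d.1 0) d' := by
  obtain ⟨N, rfl⟩ := Nat.exists_eq_succ_of_ne_zero (NeZero.ne N)
  obtain ⟨v, xi⟩ := d
  obtain ⟨hcon, hterm, -⟩ := hd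
  set z0 := initNominal x z xi
  set zN := M.nominal z0 v (Fin.last (N + 1))
  -- The candidate keeps the predicted nominal state (`ξ = 1`), so it is feasible for any measured
  -- state `x'`; its inputs are the old tail followed by the terminal feedback.
  refine ⟨(Fin.snoc (α := fun _ => Fin m → ℝ) (Fin.tail v) (M.K *ᵥ zN), 1), fun i => ?_, ?_,
    Or.inr rfl⟩
  · dsimp only
    rw [initNominal_one, M.nominal_shift z0 v]
    induction i using Fin.lastCases with
    | last =>
      -- The appended stage has absolute time at least the horizon length, where the relaxation is
      -- zero, so the terminal set's inclusions apply.
      rw [Fin.snoc_last, Fin.val_last, ha _ (by omega), hb _ (by omega)]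
      exact ⟨hZF_X hterm, hZF_U _ hterm⟩
    | cast j =>
      have h := hcon j.succ
      rw [Fin.snoc_castSucc, Fin.succ_castSucc]
      rw [Fin.val_succ, ← add_assoc, add_right_comm] at h
      exact h
  · dsimp only
    rw [initNominal_one, ← Fin.succ_last, nominal_succ, M.nominal_shift z0 v, Fin.snoc_last,
      Matrix.mulVec_mulVec, Fin.succ_last, ← Matrix.add_mulVec]
    exact hZF_inv _ hterm

variable [NeZero N] (π : ℕ → (Fin n → ℝ) → (Fin n → ℝ) → (Fin N → Fin m → ℝ) × ℝ)
  (x0 : Fin n → ℝ)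

/-- Causality of the closed loop, the source of the independence of the error from the current
noise. -/
theorem loop_congr {w w' : ℕ → Fin n → ℝ} :
    ∀ {k : ℕ}, (∀ i < k, w i = w' i) → M.loop π x0 w k = M.loop π x0 w' k
  | 0, _ => rfl
  | k + 1, h => by
    simp only [loop, loop_congr fun i hi => h i (Nat.lt_succ_of_lt hi), h k (Nat.lt_succ_self k)]

theorem measurable_loop {Ω : Type*} [MeasurableSpace Ω]
    (hπ : ∀ k, Measurable fun y : (Fin n → ℝ) × (Fin n → ℝ) => π k y.1 y.2)
    {w : ℕ → Ω → Fin n → ℝ} (hw : ∀ k, Measurable (w k)) :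
    ∀ k, Measurable fun ω => M.loop π x0 (fun i => w i ω) k
  | 0 => measurable_const
  | k + 1 => by
    have ih := measurable_loop hπ hw k
    have hd := (hπ k).comp ih
    have hd1 : Measurable fun ω => (π k (M.loop π x0 (fun i => w i ω) k).1
      (M.loop π x0 (fun i => w i ω) k).2).1 0 := (measurable_pi_apply 0).comp hd.fst
    have hd2 := hd.snd
    have hA : Measurable fun x => M.A *ᵥ x := by fun_prop
    have hB : Measurable fun x => M.B *ᵥ x := by fun_prop
    have hK : Measurable fun x => M.K *ᵥ x := by fun_prop
    have hz : Measurable fun ω => initNominal (M.loop π x0 (fun i => w i ω) k).1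
        (M.loop π x0 (fun i => w i ω) k).2 (π k (M.loop π x0 (fun i => w i ω) k).1
        (M.loop π x0 (fun i => w i ω) k).2).2 :=
      ((measurable_const.sub hd2).smul ih.fst).add (hd2.smul ih.snd)
    simp only [loop]
    exact (((hA.comp ih.fst).add (hB.comp (hd1.add (hK.comp (ih.fst.sub hz))))).add (hw k)).prodMk
      ((hA.comp hz).add (hB.comp hd1))

/-- The error `x(k) - z_0(k)` after the initialization at time `k`. -/
def error (w : ℕ → Fin n → ℝ) (k : ℕ) : Fin n → ℝ :=
  (M.loop π x0 w k).1 - initNominal (M.loop π x0 w k).1 (M.loop π x0 w k).2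
    (π k (M.loop π x0 w k).1 (M.loop π x0 w k).2).2

theorem measurable_error {Ω : Type*} [MeasurableSpace Ω]
    (hπ : ∀ k, Measurable fun y : (Fin n → ℝ) × (Fin n → ℝ) => π k y.1 y.2)
    {w : ℕ → Ω → Fin n → ℝ} (hw : ∀ k, Measurable (w k)) (k : ℕ) :
    Measurable fun ω => M.error π x0 (fun i => w i ω) k := by
  have h := M.measurable_loop π x0 hπ hw k
  have hd2 := ((hπ k).comp h).snd
  exact h.fst.sub (((measurable_const.sub hd2).smul h.fst).add (hd2.smul h.snd))

theorem indepFun_error {Ω : Type*} [MeasurableSpace Ω] {μ : Measure Ω}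
    (hπ : ∀ k, Measurable fun y : (Fin n → ℝ) × (Fin n → ℝ) => π k y.1 y.2)
    {w : ℕ → Ω → Fin n → ℝ} (hw : ∀ k, Measurable (w k)) (hind : iIndepFun w μ) (k : ℕ) :
    IndepFun (fun ω => M.error π x0 (fun i => w i ω) k) (w k) μ := by
  have h := hind.indepFun_finset (Finset.range k) {k} (by simp) hw
  -- Extending the first `k` noises by zero exhibits the error as a measurable function of them
  -- alone.
  let w' : ℕ → (Finset.range k → Fin n → ℝ) → Fin n → ℝ := fun i y =>
    if hi : i ∈ Finset.range k then y ⟨i, hi⟩ else 0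
  have hw' : ∀ i, Measurable (w' i) := fun i => by
    by_cases hi : i ∈ Finset.range k
    · simpa only [w', hi, dite_true] using measurable_pi_apply _
    · simpa only [w', hi, dite_false] using measurable_const
  have h2 := h.comp (M.measurable_error π x0 hπ hw' k)
    (measurable_pi_apply (⟨k, Finset.mem_singleton_self k⟩ : ({k} : Finset ℕ)))
  suffices e1 : (fun ω => M.error π x0 (fun i => w i ω) k) =
      (fun y => M.error π x0 (fun i => w' i y) k) ∘ fun ω (i : Finset.range k) => w i ω by
    rw [e1]
    exact h2
  ext1 ω
  simp only [error, Function.comp]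
  rw [M.loop_congr π x0 (w := fun i => w i ω)
    (w' := fun i => w' i fun j : Finset.range k => w j ω) fun i hi => by simp [w', hi]]

theorem perfFeasible_loop (hZF_inv : ∀ z ∈ M.ZF, M.AK *ᵥ z ∈ M.ZF)
    (hZF_X : M.ZF ⊆ M.tightX 0) (hZF_U : ∀ z ∈ M.ZF, M.K *ᵥ z ∈ M.tightU 0) {a b : Fin N → ℝ}
    {v : Fin N → Fin m → ℝ} (hSafety : M.SafetyFeasible x0 v a b)
    (hπ_opt : ∀ (k : ℕ) (x zprev : Fin n → ℝ),
      (∃ d : (Fin N → Fin m → ℝ) × ℝ,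
        M.PerfFeasible (extendZero a) (extendZero b) k x zprev d) →
      M.PerfOptimal (extendZero a) (extendZero b) k x zprev (π k x zprev))
    (w : ℕ → Fin n → ℝ) :
    ∀ k, M.PerfFeasible (extendZero a) (extendZero b) k (M.loop π x0 w k).1 (M.loop π x0 w k).2
      (π k (M.loop π x0 w k).1 (M.loop π x0 w k).2)
  | 0 => by
    -- The safety-step inputs start the induction; initially both candidates for the nominal state
    -- equal `x0`.
    refine (hπ_opt 0 _ _ ⟨(v, 1), fun i => ?_, ?_, Or.inr rfl⟩).1
    · rw [initNominal_one]
      have h := hSafety.1 i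
      simp only [extendZero, zero_add, i.is_lt, dite_true]
      exact ⟨h.1, h.2.1⟩
    · rw [initNominal_one]
      exact hSafety.2
  | k + 1 => by
    refine (hπ_opt (k + 1) _ _ ?_).1
    have hz : ∀ (c : Fin N → ℝ) (i : ℕ), N ≤ i → extendZero c i = 0 := fun c i hi => by
      simp [extendZero, not_lt.2 hi]
    exact (perfFeasible_loop hZF_inv hZF_X hZF_U hSafety hπ_opt w k).succ M hZF_inv hZF_X hZF_U
      (hz a) (hz b) _

end StochMPC

/-! ### The chance constraints -/

theorem theorem2 {n m N : ℕ} [NeZero N] (M : StochMPC n m)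
    -- the noise: i.i.d. with a zero-mean central convex unimodal law of positive definite variance
    {Ω : Type*} [MeasurableSpace Ω] (μ : Measure Ω) [IsProbabilityMeasure μ]
    (Q : ProbabilityMeasure (Fin n → ℝ)) (w : ℕ → Ω → Fin n → ℝ)
    (hw_meas : ∀ k, Measurable (w k))
    (hw_indep : iIndepFun w μ)
    (hw_law : ∀ k, μ.map (w k) = (Q : Measure (Fin n → ℝ)))
    (hQ_moment : MemLp id 2 (Q : Measure (Fin n → ℝ)))
    (hQ_mean : ∫ x, x ∂(Q : Measure (Fin n → ℝ)) = 0)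
    (hQ_var : (varMatrix (Q : Measure (Fin n → ℝ))).PosDef)
    (hQ_unimodal : IsCentralConvexUnimodal Q)
    -- the constraint sets and the target lower bounds
    (hX_conv : Convex ℝ M.X) (hX_int : 0 ∈ interior M.X) (hX_meas : MeasurableSet M.X)
    (hU_conv : Convex ℝ M.U) (hU_int : 0 ∈ interior M.U) (hU_meas : MeasurableSet M.U)
    (hpX : M.pbarX ∈ Ico (0 : ℝ) 1) (hpU : M.pbarU ∈ Ico (0 : ℝ) 1)
    -- the gain and the cost weight from the stabilizing solution of the Riccati equation
    (Wx P : Matrix (Fin n) (Fin n) ℝ) (Wu : Matrix (Fin m) (Fin m) ℝ)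
    (hWx : Wx.PosDef) (hWu : Wu.PosDef) (hP : P.PosSemidef)
    (hK : M.K = -((Wu + M.Bᵀ * P * M.B)⁻¹ * M.Bᵀ * P * M.A))
    (hRiccati : P = M.Aᵀ * P * M.A + M.Aᵀ * P * M.B * M.K + Wx)
    (hStable : IsSchurStable M.AK)
    (hS : M.S = Wu + M.Bᵀ * P * M.B)
    -- the ellipsoidal reachable sets
    (hLyapunov : M.AK * M.Sig * M.AKᵀ - M.Sig + varMatrix (Q : Measure (Fin n → ℝ)) = 0)
    (hRad : M.rad = chebyshevRadius n ∨
      (IsGaussian (Q : Measure (Fin n → ℝ)) ∧ M.rad = chiSquaredQuantile n))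
    -- the terminal set
    (hZF_inv : ∀ z ∈ M.ZF, M.AK *ᵥ z ∈ M.ZF)
    (hZF_X : M.ZF ⊆ M.tightX 0)
    (hZF_U : ∀ z ∈ M.ZF, M.K *ᵥ z ∈ M.tightU 0)
    -- the initial state and an optimal solution of the safety step
    (x0 : Fin n → ℝ) (v : Fin N → Fin m → ℝ) (a b : Fin N → ℝ)
    (hSafety : M.SafetyOptimal x0 v a b)
    -- the controller: an optimal solution of the performance step at every time
    (π : ℕ → (Fin n → ℝ) → (Fin n → ℝ) → (Fin N → Fin m → ℝ) × ℝ)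
    (hπ_meas : ∀ k, Measurable fun y : (Fin n → ℝ) × (Fin n → ℝ) => π k y.1 y.2)
    (hπ_opt : ∀ (k : ℕ) (x zprev : Fin n → ℝ),
      (∃ d : (Fin N → Fin m → ℝ) × ℝ,
        M.PerfFeasible (extendZero a) (extendZero b) k x zprev d) →
      M.PerfOptimal (extendZero a) (extendZero b) k x zprev (π k x zprev)) :
    ∀ k : ℕ,
      levelOf M.reachX M.pbarX (extendZero a k) ≤
        μ.real {ω | M.state π x0 (fun i => w i ω) k ∈ M.X} ∧
      levelOf M.reachU M.pbarU (extendZero b k) ≤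
        μ.real {ω | M.input π x0 (fun i => w i ω) k ∈ M.U} := by
  set e : ℕ → Ω → Fin n → ℝ := fun k ω =>
    (M.loop π x0 (fun i => w i ω) k).1 - (M.loop π x0 (fun i => w i ω) k).2 with he
  set r : ℕ → Ω → Fin n → ℝ := fun k ω => M.error π x0 (fun i => w i ω) k with hr
  have hfeas := M.perfFeasible_loop π x0 hZF_inv hZF_X hZF_U hSafety.1 hπ_opt
  have hreset : ∀ k ω, r k ω = 0 ∨ r k ω = e k ω := fun k ω => by
    rcases (hfeas (fun i => w i ω) k).2.2 with h | h
    · left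
      simp only [hr, StochMPC.error, h, StochMPC.initNominal_zero, sub_self]
    · right
      simp only [hr, he, StochMPC.error, h, StochMPC.initNominal_one]
  have hstep : ∀ k ω, e (k + 1) ω = M.AK *ᵥ r k ω + w k ω := fun k ω => by
    simp only [he, hr, StochMPC.loop, StochMPC.applied, StochMPC.error, StochMPC.AK,
      Matrix.add_mulVec, Matrix.mulVec_add, Matrix.mulVec_sub, Matrix.mulVec_mulVec]
    abel
  have hprob : ∀ p < 1, ∀ k, p ≤ μ.real {ω | r k ω ∈ M.reachX p} := fun p hp k => by
    have h := le_noiseSumLaw_real_ellipsoid hQ_moment hQ_mean hQ_var hStable hLyapunov hRad hp k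
    refine h.1.trans (noiseSumLaw_real_le hQ_unimodal hw_meas hw_law (fun k => ?_)
      (M.measurable_error π x0 hπ_meas hw_meas) (M.indepFun_error π x0 hπ_meas hw_meas hw_indep)
      (fun ω => sub_self _) hreset hstep (convex_ellipsoid _) ⟨0, h.2⟩ neg_mem_ellipsoid
      (isClosed_ellipsoid _) k)
    have h := M.measurable_loop π x0 hπ_meas hw_meas k
    exact h.fst.sub h.snd
  intro k
  have hcon := fun ω => (hfeas (fun i => w i ω) k).1 0
  simp only [Fin.val_zero, add_zero] at hcon
  -- Each admissible level is bounded separately; nonnegativity of the probability covers the case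
  -- of no admissible level, where the supremum is zero.
  refine ⟨Real.sSup_le (fun p hp => ?_) measureReal_nonneg,
    Real.sSup_le (fun p hp => ?_) measureReal_nonneg⟩
  · refine (hprob p (hp.1.2.trans_lt hpX.2) k).trans (measureReal_mono fun ω hω => ?_)
    -- For an admissible `p`, the set subtracted in the tightening is exactly the reachable set of
    -- level `p`, so adding `r k ω` to `z_0` recovers the state inside `X`.
    have h := (hcon ω).1 (r k ω) (hp.2 ▸ hω)
    simp only [hr, StochMPC.error] at h
    rw [show (Fin.castSucc (0 : Fin N)) = 0 by ext; simp, StochMPC.nominal_zero,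
      add_sub_cancel] at h
    exact h
  · refine (hprob p (hp.1.2.trans_lt hpU.2) k).trans (measureReal_mono fun ω hω => ?_)
    have hmem : M.K *ᵥ r k ω ∈ M.reachU p := mulVec_mem_ellipsoid M.K hω
    exact (hcon ω).2 _ (hp.2 ▸ hmem)
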